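/- **Notation.** Let $B_n$ be the Artin braid group on $n$ strands with standard generators $\sigma_1,\dots,\sigma_{n-1}$, let $\rho:B_n\to S_n$, $\sigma_i\mapsto(i,i+1)$, and let $PB_n=\ker\rho$ be the pure braid group. Put $x_{12}=\sigma_1^2$, $x_{23}=\sigma_2^2$, $x_{13}=\sigma_2\sigma_1^2\sigma_2^{-1}$ in $PB_3$ (and $x_{12}=\sigma_1^2$ in $PB_2$), and let $F_2=\langle x_{12},x_{23}\rangle\le PB_3$. Let $\mathsf{PaB}$ be the operad (in groupoids) of parenthesized braids: the objects of $\mathsf{PaB}(n)$ are the parenthesizations of the sequences $(\tau(1),\dots,\tau(n))$, $\tau\in S_n$; a morphism from an object with underlying permutation $\tau_1$ to one with underlying permutation $\tau_2$ is a braid $g\in B_n$ with $\rho(g)=\tau_2^{-1}\tau_1$, and composition is multiplication in $B_n$. The group $S_n$ acts by relabelling, and the elementary insertions $\gamma\circ_i\tilde\gamma$ replace the strand of $\gamma$ that starts at the position labelled $i$ by a thin copy of $\tilde\gamma$. Write $\mathfrak{ou}(\gamma)$ for the braid of a morphism $\gamma$ and, for $h\in PB_n$, $\mathfrak m(h)$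 for the automorphism of $(..(1\,2)3)\dots n)$ given by $h$. Let $\alpha:(12)3\to1(23)$ be the morphism given by $1\in B_3$ and $\beta:12\to21$ the one given by $\sigma_1\in B_2$. Let $\widehat{\mathsf{PaB}}$ be the profinite completion of $\mathsf{PaB}$: in each arity, the limit of the finite quotient groupoids by the compatible equivalence relations on morphisms. Automorphisms of $\widehat{\mathsf{PaB}}$ are automorphisms of the operad of topological groupoids that are the identity on objects. Let $N$ be a normal subgroup of finite index of $B_4$ with $N\le PB_4$. Define homomorphisms $PB_3\to PB_4$ by $\varphi_{123}(h)=\mathfrak{ou}(\mathrm{id}_{12}\circ_1\mathfrak m(h))$, $\varphi_{234}(h)=\mathfrak{ou}(\mathrm{id}_{12}\circ_2\mathfrak m(h))$, and $\varphi_{12,3,4}(h)$, $\varphi_{1,23,4}(h)$, $\varphi_{1,2,34}(h)$ as $\mathfrak{ou}(\mathfrak m(h)\circ_i\mathrm{id}_{12})$ for $i=1,2,3$. Let $N_{PB_4}=N$, let $N_{PB_3}\le PB_3$ be the intersection of the preimages of $N$ under these five homomorphisms, and let $N_{PB_2}\le PB_2$ be the intersection of the preimages of $N_{PB_3}$ under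 the four analogous homomorphisms $PB_2\to PB_3$; put $N_{\mathrm{ord}}=[PB_2:N_{PB_2}]$ and $N_{F_2}=N_{PB_3}\cap F_2$. For morphisms $\gamma,\gamma'$ of $\mathsf{PaB}(n)$, $n\le4$, with the same source and the same target, write $\gamma\sim_N\gamma'$ if $\mathfrak{ou}(\gamma^{-1}\gamma')\in N_{PB_n}$ (in arity $1$ there is nothing to identify). The quotient $\mathsf{PaB}^{\le4}/\sim_N$ is a truncated operad in finite groupoids, with a canonical projection $\widehat{\mathcal P}_N:\widehat{\mathsf{PaB}}^{\le4}\to\mathsf{PaB}^{\le4}/\sim_N$. A *GT-pair* for $N$ is a class $[(m,f)]\in\mathbb Z/N_{\mathrm{ord}}\mathbb Z\times PB_3/N_{PB_3}$, represented by $(m,f)\in\mathbb Z\times PB_3$, such that $$\sigma_1x_{12}^m f^{-1}\sigma_2x_{23}^mf\,N_{PB_3}=f^{-1}\sigma_1\sigma_2(x_{13}x_{23})^m N_{PB_3},\qquad f^{-1}\sigma_2x_{23}^mf\,\sigma_1x_{12}^m N_{PB_3}=\sigma_2\sigma_1(x_{12}x_{13})^mf\,N_{PB_3}$$ in $B_3/N_{PB_3}$,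 and $\varphi_{234}(f)\varphi_{1,23,4}(f)\varphi_{123}(f)N=\varphi_{1,2,34}(f)\varphi_{12,3,4}(f)N$ in $PB_4/N$. It corresponds to the morphism of truncated operads $T_{m,f}:\mathsf{PaB}^{\le4}\to\mathsf{PaB}^{\le4}/\sim_N$, the identity on objects, with $T_{m,f}(\alpha)=[\alpha\cdot\mathfrak m(f)]$ and $T_{m,f}(\beta)=[\beta\cdot\mathfrak m(x_{12}^m)]$. Let $T^{PB_n}_{m,f}=\mathfrak{ou}\circ T_{m,f}\circ\mathfrak m:PB_n\to PB_n/N_{PB_n}$. A GT-pair is a *GT-shadow* if $T^{PB_n}_{m,f}$ is onto for $n=2,3,4$. A GT-shadow $[(m,f)]$ is *genuine* if there is a continuous automorphism $\hat T$ of $\widehat{\mathsf{PaB}}$ such that the composite $\mathsf{PaB}^{\le4}\to\widehat{\mathsf{PaB}}^{\le4}\xrightarrow{\hat T}\widehat{\mathsf{PaB}}^{\le4}\xrightarrow{\widehat{\mathcal P}_N}\mathsf{PaB}^{\le4}/\sim_N$ is $T_{m,f}$. **Proposition.** Let $N$ be a normal subgroup of finite index of $B_4$ contained in $PB_4$. Every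 genuine GT-shadow $[(m,f)]$ for $N$ is *charming*, that is: 1. the coset $fN_{PB_3}$ is represented by an element of the commutator subgroup $[F_2,F_2]$; 2. the restriction of $T^{PB_3}_{m,f}$ to $F_2$ is a group homomorphism $T^{F_2}_{m,f}:F_2\to F_2/N_{F_2}$ (where $F_2/N_{F_2}$ is regarded as a subgroup of $PB_3/N_{PB_3}$), and it is onto. -/

import Mathlib

open CategoryTheory hiding Quotient

/-- The relations of the Artin presentation of the braid group on `n` strands. The generator
with index `i` (counted from `0`) is `σ_{i+1}`. -/
def braidRels (n : ℕ) : Set (FreeGroup (Fin (n - 1))) :=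
  {r | ∃ i j : Fin (n - 1), ((i : ℕ) + 2 ≤ j ∨ (j : ℕ) + 2 ≤ i) ∧
      r = .of i * .of j * (.of i)⁻¹ * (.of j)⁻¹} ∪
  {r | ∃ i j : Fin (n - 1), (j : ℕ) = i + 1 ∧
      r = .of i * .of j * .of i * (.of j)⁻¹ * (.of i)⁻¹ * (.of j)⁻¹}

/-- The Artin braid group on `n` strands. -/
abbrev Braid (n : ℕ) : Type := PresentedGroup (braidRels n)

namespace Braid

/-- `sig n j` is the generator `σ_{j+1}` of `Braid n`, for `j + 1 < n`. -/
def sig (n j : ℕ) : Braid n := if h : j < n - 1 then PresentedGroup.of ⟨j, h⟩ else 1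

theorem sig_of {n : ℕ} (i : Fin (n - 1)) : sig n i = PresentedGroup.of i := by
  simp [sig]

theorem sig_comm (n : ℕ) {i j : ℕ} (h : i + 2 ≤ j) : sig n i * sig n j = sig n j * sig n i := by
  unfold sig
  split_ifs with h1 h2
  · have := PresentedGroup.one_of_mem (rels := braidRels n)
      (x := .of ⟨i, h1⟩ * .of ⟨j, h2⟩ * (.of ⟨i, h1⟩)⁻¹ * (.of ⟨j, h2⟩)⁻¹)
      (Or.inl ⟨_, _, Or.inl h, rfl⟩)
    simp only [map_mul, map_inv] at this
    exact (mul_inv_eq_iff_eq_mul.mp (mul_inv_eq_one.mp this))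
  all_goals simp

theorem sig_braid (n : ℕ) {i : ℕ} (h : i + 1 < n - 1) :
    sig n i * sig n (i + 1) * sig n i = sig n (i + 1) * sig n i * sig n (i + 1) := by
  unfold sig
  rw [dif_pos h, dif_pos (by omega)]
  have := PresentedGroup.one_of_mem (rels := braidRels n)
      (x := .of ⟨i, by omega⟩ * .of ⟨i + 1, h⟩ * .of ⟨i, by omega⟩ * (.of ⟨i + 1, h⟩)⁻¹ *
        (.of ⟨i, by omega⟩)⁻¹ * (.of ⟨i + 1, h⟩)⁻¹)
      (Or.inr ⟨_, _, rfl, rfl⟩)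
  simp only [map_mul, map_inv] at this
  exact (mul_inv_eq_iff_eq_mul.mp (mul_inv_eq_iff_eq_mul.mp (mul_inv_eq_one.mp this)))

/-- A homomorphism out of the braid group, from images of the generators that satisfy the
braid relations. -/
def lift {n : ℕ} {G : Type*} [Group G] (f : Fin (n - 1) → G)
    (hc : ∀ i j : Fin (n - 1), (i : ℕ) + 2 ≤ j → f i * f j = f j * f i)
    (hb : ∀ i j : Fin (n - 1), (j : ℕ) = i + 1 → f i * f j * f i = f j * f i * f j) :
    Braid n →* G :=
  PresentedGroup.toGroup (f := f) (by
    rintro r (⟨i, j, h | h, rfl⟩ | ⟨i, j, h, rfl⟩)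
    · simp [hc i j h]
    · have h := hc j i h
      simp [← h]
    · simp [hb i j h])

@[simp] theorem lift_of {n : ℕ} {G : Type*} [Group G] (f : Fin (n - 1) → G) (hc) (hb)
    (i : Fin (n - 1)) : lift f hc hb (PresentedGroup.of i) = f i :=
  PresentedGroup.toGroup.of _

theorem induction {n : ℕ} {C : Braid n → Prop} (g : Braid n) (h1 : C 1)
    (hg : ∀ i : Fin (n - 1), C (PresentedGroup.of i))
    (hm : ∀ x y, C x → C y → C (x * y)) (hi : ∀ x, C x → C x⁻¹) : C g := by
  have : g ∈ Subgroup.closure (Set.range (PresentedGroup.of (rels := braidRels n))) := by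
    rw [PresentedGroup.closure_range_of]; trivial
  induction this using Subgroup.closure_induction with
  | mem x hx => obtain ⟨i, rfl⟩ := hx; exact hg i
  | one => exact h1
  | mul x y _ _ hx hy => exact hm x y hx hy
  | inv x _ hx => exact hi x hx

/-- The adjacent transposition of the positions `i` and `i + 1`. -/
def adjSwap {n : ℕ} (i : Fin (n - 1)) : Equiv.Perm (Fin n) :=
  Equiv.swap ⟨i, by omega⟩ ⟨i + 1, by omega⟩

theorem adjSwap_val {n : ℕ} (i : Fin (n - 1)) (q : Fin n) :
    (adjSwap i q : ℕ) = if (q : ℕ) = i then (i : ℕ) + 1 else if (q : ℕ) = i + 1 then i else q := by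
  unfold adjSwap
  rw [Equiv.swap_apply_def]
  simp only [Fin.ext_iff]
  split_ifs <;> rfl

theorem adjSwap_inv {n : ℕ} (i : Fin (n - 1)) : (adjSwap i)⁻¹ = adjSwap i := Equiv.swap_inv _ _

theorem swap_braid {α : Type*} [DecidableEq α] {x y z : α} (hxy : x ≠ y) (hxz : x ≠ z)
    (hyz : y ≠ z) : Equiv.swap x y * Equiv.swap y z * Equiv.swap x y =
      Equiv.swap y z * Equiv.swap x y * Equiv.swap y z := by
  rw [Equiv.swap_mul_swap_mul_swap hxy hxz, Equiv.swap_comm x y, Equiv.swap_comm y z,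
    Equiv.swap_mul_swap_mul_swap hyz.symm hxz.symm, Equiv.swap_comm]

/-- The standard homomorphism `ρ` from the braid group to the symmetric group. -/
def rho (n : ℕ) : Braid n →* Equiv.Perm (Fin n) :=
  lift adjSwap
    (by
      intro i j h; ext q
      simp only [Equiv.Perm.mul_apply, adjSwap_val]
      split_ifs <;> omega)
    (by
      rintro i ⟨j, hj⟩ h
      obtain rfl : j = i + 1 := h
      exact swap_braid (by simp) (by simp; omega) (by simp))

@[simp] theorem rho_of {n : ℕ} (i : Fin (n - 1)) : rho n (PresentedGroup.of i) = adjSwap i :=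
  lift_of _ _ _ _

theorem rho_sig_val {n j : ℕ} (h : j < n - 1) (q : Fin n) :
    (rho n (sig n j) q : ℕ) = if (q : ℕ) = j then j + 1 else if (q : ℕ) = j + 1 then j else q := by
  have := adjSwap_val ⟨j, h⟩ q
  rw [sig, dif_pos h, rho_of]; exact this

/-- `blockOver n a m` is the braid in which the strands at the `m` consecutive positions
`a, …, a + m - 1` move, in parallel, over the strand at position `a + m`. -/
def blockOver (n a : ℕ) : ℕ → Braid n
  | 0 => 1
  | m + 1 => blockOver n a m * sig n (a + m)

/-- `strandOver n a m` is the braid in which the strand at position `a` moves over the `m` parallel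
strands at the positions `a + 1, …, a + m`. -/
def strandOver (n a : ℕ) : ℕ → Braid n
  | 0 => 1
  | m + 1 => sig n (a + m) * strandOver n a m

theorem sig_comm_blockOver (n : ℕ) {i a m : ℕ} (h : i + 2 ≤ a ∨ a + m < i) :
    sig n i * blockOver n a m = blockOver n a m * sig n i := by
  induction m with
  | zero => simp [blockOver]
  | succ m ih =>
    have hs : sig n i * sig n (a + m) = sig n (a + m) * sig n i := by
      rcases h with h | h
      · exact sig_comm n (by omega)
      · exact (sig_comm n (by omega)).symm
    rw [blockOver, ← mul_assoc, ih (by omega), mul_assoc, hs, mul_assoc]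

theorem sig_comm_strandOver (n : ℕ) {i a m : ℕ} (h : i + 2 ≤ a ∨ a + m < i) :
    sig n i * strandOver n a m = strandOver n a m * sig n i := by
  induction m with
  | zero => simp [strandOver]
  | succ m ih =>
    have hs : sig n i * sig n (a + m) = sig n (a + m) * sig n i := by
      rcases h with h | h
      · exact sig_comm n (by omega)
      · exact (sig_comm n (by omega)).symm
    rw [strandOver, ← mul_assoc, hs, mul_assoc, ih (by omega), mul_assoc]

theorem blockOver_succ (n a m : ℕ) : blockOver n a (m + 1) = sig n a * blockOver n (a + 1) m := by
  induction m with
  | zero => simp [blockOver]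
  | succ m ih => rw [blockOver, ih, blockOver, mul_assoc]; congr 3; omega

theorem strandOver_succ (n a m : ℕ) : strandOver n a (m + 1) = strandOver n (a + 1) m * sig n a := by
  induction m with
  | zero => simp [strandOver]
  | succ m ih => rw [strandOver, ih, strandOver, mul_assoc]; congr 2; omega

theorem blockOver_sig (n : ℕ) {i a m : ℕ} (h1 : a ≤ i) (h2 : i + 1 < a + m) (h3 : a + m ≤ n - 1) :
    blockOver n a m * sig n i = sig n (i + 1) * blockOver n a m := by
  induction m with
  | zero => omega
  | succ m ih =>
    by_cases h : i + 1 < a + m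
    · rw [blockOver, mul_assoc, ← sig_comm n (show i + 2 ≤ a + m by omega), ← mul_assoc,
        ih h (by omega), mul_assoc]
    · obtain ⟨k, rfl⟩ : ∃ k, m = k + 1 := ⟨m - 1, by omega⟩
      obtain rfl : i = a + k := by omega
      have hb := sig_braid n (i := a + k) (by omega)
      have hc := sig_comm_blockOver n (i := a + k + 1) (a := a) (m := k) (Or.inr (by omega))
      simp only [blockOver, ← add_assoc]
      calc blockOver n a k * sig n (a + k) * sig n (a + k + 1) * sig n (a + k)
          = blockOver n a k * (sig n (a + k) * sig n (a + k + 1) * sig n (a + k)) := by group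
        _ = (blockOver n a k * sig n (a + k + 1)) * sig n (a + k) * sig n (a + k + 1) := by
            rw [hb]; group
        _ = _ := by rw [← hc]; group

theorem sig_strandOver (n : ℕ) {i a m : ℕ} (h1 : a ≤ i) (h2 : i + 1 < a + m) (h3 : a + m ≤ n - 1) :
    sig n i * strandOver n a m = strandOver n a m * sig n (i + 1) := by
  induction m with
  | zero => omega
  | succ m ih =>
    by_cases h : i + 1 < a + m
    · rw [strandOver, ← mul_assoc, sig_comm n (show i + 2 ≤ a + m by omega), mul_assoc,
        ih h (by omega), mul_assoc]
    · obtain ⟨k, rfl⟩ : ∃ k, m = k + 1 := ⟨m - 1, by omega⟩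
      obtain rfl : i = a + k := by omega
      have hb := sig_braid n (i := a + k) (by omega)
      have hc := sig_comm_strandOver n (i := a + k + 1) (a := a) (m := k) (Or.inr (by omega))
      simp only [strandOver, ← add_assoc]
      calc sig n (a + k) * (sig n (a + k + 1) * (sig n (a + k) * strandOver n a k))
          = (sig n (a + k) * sig n (a + k + 1) * sig n (a + k)) * strandOver n a k := by group
        _ = sig n (a + k + 1) * sig n (a + k) * (sig n (a + k + 1) * strandOver n a k) := by
            rw [hb]; group
        _ = _ := by rw [hc]; group

theorem blockOver_blockOver (n : ℕ) {a m : ℕ} (h : a + m < n - 1) :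
    sig n a * blockOver n (a + 1) m * blockOver n a m = blockOver n (a + 1) m * blockOver n a m * sig n (a + m) := by
  rw [← blockOver_succ]
  have key : ∀ k, k ≤ m →
      blockOver n a (m + 1) * blockOver n a k = blockOver n (a + 1) k * blockOver n a (m + 1) := by
    intro k hk
    induction k with
    | zero => simp [blockOver]
    | succ k ih =>
      rw [show blockOver n a (k + 1) = blockOver n a k * sig n (a + k) from rfl, ← mul_assoc,
        ih (by omega), mul_assoc, blockOver_sig n (by omega) (by omega) (by omega),
        show blockOver n (a + 1) (k + 1) = blockOver n (a + 1) k * sig n (a + 1 + k) from rfl,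
        mul_assoc]
      congr 3; omega
  rw [key m le_rfl, blockOver, ← mul_assoc]

theorem strandOver_strandOver (n : ℕ) {a m : ℕ} (h : a + m < n - 1) :
    sig n (a + m) * strandOver n a m * strandOver n (a + 1) m
      = strandOver n a m * strandOver n (a + 1) m * sig n a := by
  have key : ∀ k, k ≤ m →
      strandOver n a k * strandOver n a (m + 1) = strandOver n a (m + 1) * strandOver n (a + 1) k := by
    intro k hk
    induction k with
    | zero => simp [strandOver]
    | succ k ih =>
      rw [strandOver, mul_assoc, ih (by omega), ← mul_assoc,
        sig_strandOver n (by omega) (by omega) (by omega), strandOver, mul_assoc]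
      congr 3; omega
  have h2 := key m le_rfl
  rw [mul_assoc (strandOver n a m), ← strandOver_succ, h2, strandOver]

theorem blockOver_strandOver (n : ℕ) {a m : ℕ} (h : a + m < n - 1) :
    blockOver n a m * sig n (a + m) * strandOver n a m
      = strandOver n (a + 1) m * sig n a * blockOver n (a + 1) m := by
  have key : ∀ k, k ≤ m →
      blockOver n a (m + 1) * strandOver n a k = strandOver n (a + 1) k * blockOver n a (m + 1) := by
    intro k hk
    induction k with
    | zero => simp [strandOver]
    | succ k ih =>
      rw [strandOver, ← mul_assoc, blockOver_sig n (by omega) (by omega) (by omega), mul_assoc,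
        ih (by omega), strandOver, mul_assoc]
      congr 2; omega
  have h2 := key m le_rfl
  rw [mul_assoc (strandOver n (a + 1) m), ← blockOver_succ, ← h2, blockOver]

theorem rho_blockOver_val {n a m : ℕ} (h : a + m ≤ n - 1) (q : Fin n) :
    (rho n (blockOver n a m) q : ℕ) =
      if a ≤ (q : ℕ) ∧ (q : ℕ) < a + m then (q : ℕ) + 1 else if (q : ℕ) = a + m then a else q := by
  induction m generalizing q with
  | zero => simp only [blockOver, map_one, Equiv.Perm.one_apply]; split_ifs <;> omega
  | succ m ih =>
    rw [blockOver, map_mul, Equiv.Perm.mul_apply, ih (by omega), rho_sig_val (by omega)]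
    split_ifs <;> omega

theorem rho_strandOver_val {n a m : ℕ} (h : a + m ≤ n - 1) (q : Fin n) :
    (rho n (strandOver n a m) q : ℕ) =
      if (q : ℕ) = a then a + m else if a < (q : ℕ) ∧ (q : ℕ) ≤ a + m then (q : ℕ) - 1 else q := by
  induction m generalizing q with
  | zero => simp only [strandOver, map_one, Equiv.Perm.one_apply]; split_ifs <;> omega
  | succ m ih =>
    rw [strandOver, map_mul, Equiv.Perm.mul_apply, rho_sig_val (by omega), ih (by omega)]
    split_ifs <;> omega

/-- The braid obtained from the generator `σ_{j+1}` by replacing the strand that ends at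
position `q` by `m` parallel strands; `k` is the resulting number of strands. -/
def cableGen (k m q j : ℕ) : Braid k :=
  if q < j then sig k (j + m - 1)
  else if q = j then strandOver k j m
  else if q = j + 1 then blockOver k j m
  else sig k j

theorem cableGen_comm {m k : ℕ} {q i j : ℕ} (hij : i + 2 ≤ j) :
    cableGen k m q i * cableGen k m (if q = i then i + 1 else if q = i + 1 then i else q) j =
    cableGen k m q j * cableGen k m (if q = j then j + 1 else if q = j + 1 then j else q) i := by
  unfold cableGen
  rcases lt_trichotomy q i with h | rfl | h
  · simp only [h, if_true, show q < j by omega, show q ≠ i by omega, show q ≠ j by omega,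
      show q ≠ i + 1 by omega, show q ≠ j + 1 by omega, if_false]
    exact sig_comm _ (by omega)
  · simp only [if_true, lt_irrefl, if_false, show q + 1 < j by omega, show q < j by omega,
      show q ≠ j by omega, show q ≠ j + 1 by omega]
    exact (sig_comm_strandOver _ (by omega)).symm
  rcases lt_trichotomy q (i + 1) with h' | rfl | h'
  · omega
  · simp only [if_true, if_false, show i < j by omega, show i + 1 < j by omega,
      show i + 1 ≠ j by omega, show i + 1 ≠ j + 1 by omega, show i + 1 ≠ i by omega,
      show ¬ (i + 1 < i) by omega]
    exact (sig_comm_blockOver _ (by omega)).symm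
  have h1 : ¬ q < i := by omega
  have h2 : q ≠ i := by omega
  have h3 : q ≠ i + 1 := by omega
  rcases lt_trichotomy q j with h4 | rfl | h4
  · simp only [h1, h2, h3, if_false, h4, if_true, h4.ne, show q ≠ j + 1 by omega]
    exact sig_comm _ (by omega)
  · simp only [h1, h2, h3, if_false, if_true, lt_irrefl, show ¬ q + 1 < i by omega,
      show q + 1 ≠ i by omega, show q + 1 ≠ i + 1 by omega]
    exact sig_comm_strandOver _ (by omega)
  rcases eq_or_ne q (j + 1) with rfl | h5
  · simp only [h1, h2, h3, if_false, if_true, show ¬ j + 1 < j by omega,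
      show j + 1 ≠ j by omega, show ¬ j < i by omega, show j ≠ i by omega,
      show j ≠ i + 1 by omega]
    exact sig_comm_blockOver _ (by omega)
  · simp only [h1, h2, h3, if_false, h5, h4.ne', show ¬ q < j by omega]
    exact sig_comm _ (by omega)

theorem cableGen_braid {n m k : ℕ} (hk : n + m = k + 1) {q i : ℕ} (hq : q < n) (hi : i + 1 < n - 1)
    (s : ℕ → ℕ → ℕ) (hs : ∀ a q, s a q = if q = a then a + 1 else if q = a + 1 then a else q) :
    cableGen k m q i * cableGen k m (s i q) (i + 1) * cableGen k m (s (i + 1) (s i q)) i =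
    cableGen k m q (i + 1) * cableGen k m (s (i + 1) q) i *
      cableGen k m (s i (s (i + 1) q)) (i + 1) := by
  rcases lt_trichotomy q i with h | rfl | h
  · rw [show s i q = q by rw [hs]; split_ifs <;> omega,
      show s (i + 1) q = q by rw [hs]; split_ifs <;> omega,
      show s i q = q by rw [hs]; split_ifs <;> omega]
    simp only [cableGen, h, if_true, show q < i + 1 by omega]
    have := sig_braid k (i := i + m - 1) (by omega)
    rwa [show i + m - 1 + 1 = i + 1 + m - 1 by omega] at this
  · rw [show s q q = q + 1 by rw [hs]; split_ifs <;> omega,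
      show s (q + 1) q = q by rw [hs]; split_ifs <;> omega,
      show s q q = q + 1 by rw [hs]; split_ifs <;> omega,
      show s (q + 1) (q + 1) = q + 2 by rw [hs]; split_ifs <;> omega]
    have e : q + 1 + m - 1 = q + m := by omega
    simp [cableGen, e]
    have := strandOver_strandOver k (a := q) (m := m) (by omega)
    exact this.symm
  rcases lt_trichotomy q (i + 1) with h' | rfl | h'
  · omega
  · rw [show s i (i + 1) = i by rw [hs]; split_ifs <;> omega,
      show s (i + 1) (i + 1) = i + 2 by rw [hs]; split_ifs <;> omega,
      show s i (i + 2) = i + 2 by rw [hs]; split_ifs <;> omega,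
      show s (i + 1) i = i by rw [hs]; split_ifs <;> omega]
    have e : i + 1 + m - 1 = i + m := by omega
    simp [cableGen, e]
    exact blockOver_strandOver k (by omega)
  rcases eq_or_ne q (i + 2) with rfl | h2
  · rw [show s i (i + 2) = i + 2 by rw [hs]; split_ifs <;> omega,
      show s (i + 1) (i + 2) = i + 1 by rw [hs]; split_ifs <;> omega,
      show s i (i + 1) = i by rw [hs]; split_ifs <;> omega]
    have e : i + 1 + m - 1 = i + m := by omega
    simp [cableGen, e]
    exact blockOver_blockOver k (by omega)
  · have e1 : s i q = q := by rw [hs]; split_ifs <;> omega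
    have e2 : s (i + 1) q = q := by rw [hs]; split_ifs <;> omega
    simp only [e1, e2, cableGen, show ¬ q < i by omega, show q ≠ i by omega, show q ≠ i + 1 by omega,
      show ¬ q < i + 1 by omega, show q ≠ i + 1 + 1 by omega, if_false]
    exact sig_braid k (by omega)

theorem wreath_left {n : ℕ} {G : Type*} [Group G]
    (x y : (Fin n → G) ⋊[mulAutArrow] Equiv.Perm (Fin n)) (q : Fin n) :
    (x * y).left q = x.left q * y.left (x.right⁻¹ q) := rfl

/-- Cabling: to a braid `g` on `n` strands, assign its permutation and the family of
the braids on `k = n + m - 1` strands obtained by replacing the strand of `g` that ends at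
position `q` by `m` parallel strands. -/
def cableHom (n m k : ℕ) (hk : n + m = k + 1) :
    Braid n →* ((Fin n → Braid k) ⋊[mulAutArrow] Equiv.Perm (Fin n)) :=
  lift (fun j => ⟨fun q => cableGen k m q j, adjSwap j⟩)
    (by
      intro i j h
      ext1
      · funext q
        have := cableGen_comm (m := m) (k := k) (q := q) h
        simp only [← adjSwap_val] at this
        simpa only [wreath_left, adjSwap_inv] using this
      · have := congrArg (rho n) (sig_comm n h)
        simpa [sig_of] using this)
    (by
      intro i j h
      obtain ⟨j, hj⟩ := j
      obtain rfl : j = i + 1 := h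
      ext1
      · funext q
        have := cableGen_braid hk (q := q) (i := i) q.2 hj _ (fun a q => rfl)
        simpa only [wreath_left, SemidirectProduct.mul_right, mul_inv_rev, adjSwap_inv,
          Equiv.Perm.mul_apply, adjSwap_val] using this
      · have := congrArg (rho n) (sig_braid n (i := i) hj)
        simpa [sig_of, sig, hj] using this)


theorem cableHom_right {n m k : ℕ} (hk : n + m = k + 1) (g : Braid n) :
    (cableHom n m k hk g).right = rho n g := by
  have : SemidirectProduct.rightHom.comp (cableHom n m k hk) = rho n :=
    PresentedGroup.ext fun i => by simp [cableHom]
  exact DFunLike.congr_fun this g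

/-- `cable hk g p` is the braid obtained from the braid `g` on `n` strands by replacing the strand
that starts at position `p` by `m` parallel strands. -/
def cable {n m k : ℕ} (hk : n + m = k + 1) (g : Braid n) (p : Fin n) : Braid k :=
  (cableHom n m k hk g).left (rho n g p)

theorem cable_mul {n m k : ℕ} (hk : n + m = k + 1) (g h : Braid n) (p : Fin n) :
    cable hk (g * h) p = cable hk g (rho n h p) * cable hk h p := by
  simp [cable, wreath_left, cableHom_right]

@[simp] theorem cable_one {n m k : ℕ} (hk : n + m = k + 1) (p : Fin n) :
    cable hk 1 p = 1 := by
  simp [cable]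

theorem cable_inv {n m k : ℕ} (hk : n + m = k + 1) (g : Braid n) (p : Fin n) :
    cable hk g⁻¹ p = (cable hk g ((rho n g)⁻¹ p))⁻¹ := by
  have := cable_mul hk g g⁻¹ p
  rw [mul_inv_cancel, cable_one, map_inv] at this
  exact (inv_eq_of_mul_eq_one_right this.symm).symm

theorem cable_of {n m k : ℕ} (hk : n + m = k + 1) (i : Fin (n - 1)) (p : Fin n) :
    cable hk (PresentedGroup.of i) p = cableGen k m (adjSwap i p) i := by
  simp [cable, cableHom]

/-- The homomorphism that places a braid on `m` strands at the consecutive positions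
`p, …, p + m - 1` among `k` strands, all other strands being vertical. -/
def shift (m k p : ℕ) (h : p + m ≤ k) : Braid m →* Braid k :=
  lift (fun j => sig k (p + j))
    (fun _ _ hij => sig_comm k (by omega))
    (by
      rintro i ⟨j, hj⟩ hij
      obtain rfl : j = i + 1 := hij
      exact sig_braid k (by omega))

@[simp] theorem shift_of {m k p : ℕ} (h : p + m ≤ k) (j : Fin (m - 1)) :
    shift m k p h (PresentedGroup.of j) = sig k (p + j) := lift_of _ _ _ _

theorem cable_shift {n m k : ℕ} (hk : n + m = k + 1) (g : Braid n) (h : Braid m) (p : Fin n) :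
    cable hk g p * shift m k p (by omega) h =
      shift m k (rho n g p) (by omega) h * cable hk g p := by
  induction g using Braid.induction generalizing p with
  | h1 => simp
  | hg i =>
    induction h using Braid.induction with
    | h1 => simp
    | hg j =>
      rw [cable_of, shift_of, shift_of, rho_of, adjSwap_val]
      unfold cableGen
      rcases lt_trichotomy (p : ℕ) i with h | h | h
      · simp only [h, if_true, h.ne, show (p : ℕ) ≠ i + 1 by omega, if_false]
        exact (sig_comm _ (by omega)).symm
      · simp only [h, if_true, show ¬ (i : ℕ) + 1 < i by omega, if_false,
          show (i : ℕ) + 1 ≠ i by omega]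
        rw [blockOver_sig k (by omega) (by omega) (by omega)]
        congr 2; omega
      rcases eq_or_ne (p : ℕ) (i + 1) with h' | h'
      · simp only [h', if_true, lt_irrefl, if_false, show (i : ℕ) + 1 ≠ i by omega]
        rw [sig_strandOver k (by omega) (by omega) (by omega)]
        congr 2; omega
      · simp only [h', h.ne', if_false, show ¬ (p : ℕ) < i by omega]
        exact sig_comm _ (by omega)
    | hm x y hx hy => rw [map_mul, map_mul, ← mul_assoc, hx, mul_assoc, hy, mul_assoc]
    | hi x hx =>
      rw [map_inv, map_inv, eq_inv_mul_iff_mul_eq, ← mul_assoc, ← hx, mul_inv_cancel_right]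
  | hm x y hx hy =>
    rw [cable_mul, mul_assoc, hy, ← mul_assoc, hx, mul_assoc]
    simp only [map_mul, Equiv.Perm.mul_apply]
  | hi x hx =>
    have := hx ((rho n x)⁻¹ p)
    have e : rho n x ((rho n x)⁻¹ p) = p := Equiv.apply_symm_apply _ _
    simp only [e] at this
    rw [cable_inv, inv_mul_eq_iff_eq_mul, ← mul_assoc]
    simp only [map_inv]
    rw [this, mul_inv_cancel_right]

end Braid

/-- The ordered set `Fin n` with the element `p` replaced by a block of `m` consecutive elements,
identified with `Fin k`, where `k = n + m - 1`. -/
def blockEquiv {n m k : ℕ} (hk : n + m = k + 1) (p : Fin n) :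
    {x : Fin n // x ≠ p} ⊕ Fin m ≃ Fin k where
  toFun
    | .inl x => ⟨if (x.1 : ℕ) < p then x.1 else x.1 + m - 1, by
        have := x.2; have := x.1.2; have := Fin.val_ne_of_ne x.2; split_ifs <;> omega⟩
    | .inr y => ⟨p + y, by omega⟩
  invFun z :=
    if h : (z : ℕ) < p then .inl ⟨⟨z, by omega⟩, by simp [Fin.ext_iff]; omega⟩
    else if h' : (z : ℕ) < p + m then .inr ⟨z - p, by omega⟩
    else .inl ⟨⟨z + 1 - m, by omega⟩, by simp [Fin.ext_iff]; omega⟩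
  left_inv := by
    rintro (⟨x, hx⟩ | y)
    · have hx' := Fin.val_ne_of_ne hx
      by_cases h : (x : ℕ) < p
      · simp [h]
      · simp only [h, if_false]
        rw [dif_neg (by omega), dif_neg (by omega)]
        simp only [Sum.inl.injEq, Subtype.mk.injEq, Fin.ext_iff]
        omega
    · simp
  right_inv := by
    intro z
    by_cases h : (z : ℕ) < p
    · simp [h]
    · by_cases h' : (z : ℕ) < p + m
      · simp only [h, h', dif_pos, dif_neg, not_false_eq_true, Fin.ext_iff]; omega
      · simp only [h, h', dif_neg, not_false_eq_true, Fin.ext_iff]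
        rw [if_neg (by omega)]; omega

theorem blockEquiv_inl {n m k : ℕ} (hk : n + m = k + 1) (p : Fin n) (x : {x : Fin n // x ≠ p}) :
    (blockEquiv hk p (.inl x) : ℕ) = if (x.1 : ℕ) < p then (x.1 : ℕ) else x.1 + m - 1 := rfl

theorem blockEquiv_inr {n m k : ℕ} (hk : n + m = k + 1) (p : Fin n) (y : Fin m) :
    (blockEquiv hk p (.inr y) : ℕ) = p + y := rfl

/-- The insertion of the permutation `t` of `m` letters in place of the letter `p` of the
permutation `s` of `n` letters. -/
def insPerm {n m k : ℕ} (hk : n + m = k + 1) (s : Equiv.Perm (Fin n)) (t : Equiv.Perm (Fin m))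
    (p : Fin n) : Equiv.Perm (Fin k) :=
  (blockEquiv hk p).symm.trans
    ((Equiv.sumCongr (s.subtypeEquiv fun _ => (s.injective.ne_iff (y := p)).symm) t).trans
      (blockEquiv hk (s p)))

theorem insPerm_inl {n m k : ℕ} (hk : n + m = k + 1) (s : Equiv.Perm (Fin n))
    (t : Equiv.Perm (Fin m)) (p : Fin n) (x : {x : Fin n // x ≠ p}) :
    insPerm hk s t p (blockEquiv hk p (.inl x)) =
      blockEquiv hk (s p) (.inl ⟨s x, s.injective.ne x.2⟩) := by
  simp [insPerm]

theorem insPerm_inr {n m k : ℕ} (hk : n + m = k + 1) (s : Equiv.Perm (Fin n))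
    (t : Equiv.Perm (Fin m)) (p : Fin n) (y : Fin m) :
    insPerm hk s t p (blockEquiv hk p (.inr y)) = blockEquiv hk (s p) (.inr (t y)) := by
  simp [insPerm]

theorem insPerm_mul {n m k : ℕ} (hk : n + m = k + 1) (s s' : Equiv.Perm (Fin n))
    (t t' : Equiv.Perm (Fin m)) (p : Fin n) :
    insPerm hk (s * s') (t * t') p = insPerm hk s t (s' p) * insPerm hk s' t' p := by
  apply Equiv.ext
  intro z
  obtain ⟨w, rfl⟩ := (blockEquiv hk p).surjective z
  rcases w with x | y
  · rw [Equiv.Perm.mul_apply, insPerm_inl, insPerm_inl, insPerm_inl]; rfl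
  · rw [Equiv.Perm.mul_apply, insPerm_inr, insPerm_inr, insPerm_inr]; rfl

theorem insPerm_one {n m k : ℕ} (hk : n + m = k + 1) (p : Fin n) :
    insPerm hk 1 1 p = 1 := by
  have := insPerm_mul hk 1 1 1 1 p
  simpa using this

namespace Braid

theorem rho_cable {n m k : ℕ} (hk : n + m = k + 1) (g : Braid n) (p : Fin n) :
    rho k (cable hk g p) = insPerm hk (rho n g) 1 p := by
  induction g using Braid.induction generalizing p with
  | h1 => simp [insPerm_one]
  | hg i =>
    apply Equiv.ext
    intro z
    obtain ⟨w, rfl⟩ := (blockEquiv hk p).surjective z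
    apply Fin.ext
    rw [cable_of, adjSwap_val]
    unfold cableGen
    rcases w with x | y
    · have hx := Fin.val_ne_of_ne x.2
      rw [insPerm_inl, blockEquiv_inl, rho_of, adjSwap_val, adjSwap_val]
      rcases lt_trichotomy (p : ℕ) i with h | h | h
      · simp only [h, if_true, h.ne, show (p : ℕ) ≠ i + 1 by omega, if_false]
        rw [rho_sig_val (by omega), blockEquiv_inl]
        split_ifs <;> omega
      · simp only [h, if_true, show ¬ (i : ℕ) + 1 < i by omega, if_false,
          show (i : ℕ) + 1 ≠ i by omega]
        rw [rho_blockOver_val (by omega), blockEquiv_inl]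
        split_ifs <;> omega
      rcases eq_or_ne (p : ℕ) (i + 1) with h' | h'
      · simp only [h', if_true, lt_irrefl, if_false, show (i : ℕ) + 1 ≠ i by omega]
        rw [rho_strandOver_val (by omega), blockEquiv_inl]
        split_ifs <;> omega
      · simp only [h', h.ne', if_false, show ¬ (p : ℕ) < i by omega]
        rw [rho_sig_val (by omega), blockEquiv_inl]
        split_ifs <;> omega
    · rw [insPerm_inr, blockEquiv_inr, rho_of, adjSwap_val]
      rcases lt_trichotomy (p : ℕ) i with h | h | h
      · simp only [h, if_true, h.ne, show (p : ℕ) ≠ i + 1 by omega, if_false]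
        rw [rho_sig_val (by omega), blockEquiv_inr, Equiv.Perm.one_apply]
        split_ifs <;> omega
      · simp only [h, if_true, show ¬ (i : ℕ) + 1 < i by omega, if_false,
          show (i : ℕ) + 1 ≠ i by omega]
        rw [rho_blockOver_val (by omega), blockEquiv_inr, Equiv.Perm.one_apply]
        split_ifs <;> omega
      rcases eq_or_ne (p : ℕ) (i + 1) with h' | h'
      · simp only [h', if_true, lt_irrefl, if_false, show (i : ℕ) + 1 ≠ i by omega]
        rw [rho_strandOver_val (by omega), blockEquiv_inr, Equiv.Perm.one_apply]
        split_ifs <;> omega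
      · simp only [h', h.ne', if_false, show ¬ (p : ℕ) < i by omega]
        rw [rho_sig_val (by omega), blockEquiv_inr, Equiv.Perm.one_apply]
        split_ifs <;> omega
  | hm x y hx hy =>
    rw [cable_mul, map_mul, hx, hy, map_mul]
    exact (insPerm_mul hk _ _ 1 1 p).symm
  | hi x hx =>
    rw [cable_inv, map_inv, hx, inv_eq_iff_mul_eq_one, map_inv]
    have := insPerm_mul hk (rho n x) (rho n x)⁻¹ 1 1 p
    rw [mul_inv_cancel, one_mul, insPerm_one] at this
    exact this.symm

theorem rho_shift {n m k : ℕ} (hk : n + m = k + 1) (h : Braid m) (p : Fin n) :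
    rho k (shift m k p (by omega) h) = insPerm hk 1 (rho m h) p := by
  induction h using Braid.induction with
  | h1 => simp [insPerm_one]
  | hg j =>
    apply Equiv.ext
    intro z
    obtain ⟨w, rfl⟩ := (blockEquiv hk p).surjective z
    apply Fin.ext
    rw [shift_of, rho_sig_val (by omega)]
    rcases w with x | y
    · have hx := Fin.val_ne_of_ne x.2
      rw [insPerm_inl, blockEquiv_inl, blockEquiv_inl]
      change _ = if (x.1 : ℕ) < p then (x.1 : ℕ) else x.1 + m - 1
      split_ifs <;> omega
    · rw [insPerm_inr, blockEquiv_inr, blockEquiv_inr, rho_of, adjSwap_val]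
      simp only [Equiv.Perm.one_apply]
      split_ifs <;> omega
  | hm x y hx hy =>
    rw [map_mul, map_mul, hx, hy, map_mul]
    exact (insPerm_mul hk 1 1 _ _ p).symm
  | hi x hx =>
    rw [map_inv, map_inv, hx, inv_eq_iff_mul_eq_one, map_inv]
    have := insPerm_mul hk 1 1 (rho m x) (rho m x)⁻¹ p
    rw [mul_inv_cancel, one_mul, insPerm_one] at this
    exact this.symm

/-- The insertion of a thin version of the braid `h` in place of the strand of `g` that starts
at position `p`. -/
def insert {n m k : ℕ} (hk : n + m = k + 1) (g : Braid n) (h : Braid m) (p : Fin n) : Braid k :=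
  cable hk g p * shift m k p (by omega) h

theorem rho_insert {n m k : ℕ} (hk : n + m = k + 1) (g : Braid n) (h : Braid m) (p : Fin n) :
    rho k (insert hk g h p) = insPerm hk (rho n g) (rho m h) p := by
  rw [insert, map_mul, rho_cable, rho_shift]
  simpa using (insPerm_mul hk (rho n g) 1 1 (rho m h) p).symm

theorem insert_mul {n m k : ℕ} (hk : n + m = k + 1) (g g' : Braid n) (h h' : Braid m)
    (p : Fin n) :
    insert hk (g * g') (h * h') p = insert hk g h (rho n g' p) * insert hk g' h' p := by
  unfold insert
  rw [cable_mul, map_mul, mul_assoc, ← mul_assoc (cable hk g' p), cable_shift]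
  simp only [mul_assoc]

@[simp] theorem insert_one {n m k : ℕ} (hk : n + m = k + 1) (p : Fin n) :
    insert hk (1 : Braid n) (1 : Braid m) p = 1 := by
  simp [insert]

end Braid

/-- The pure braid group on `n` strands. -/
abbrev PB (n : ℕ) : Subgroup (Braid n) := (Braid.rho n).ker

/-- An object of the groupoid `PaB(n)`: a parenthesization (a word of length `n` in the free magma
on one letter) of the sequence `(perm 0, …, perm (n - 1))`; the labels are counted from `0`. -/
@[ext] structure PaB (n : ℕ) where
  shape : FreeMagma Unit
  length_shape : shape.length = n
  perm : Equiv.Perm (Fin n)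

/-- Morphisms of `PaB(n)`: the braids on `n` strands with the permutation that source and target
prescribe. -/
@[ext] structure PaBHom {n : ℕ} (a b : PaB n) where
  ou : Braid n
  rho_ou : Braid.rho n ou = b.perm⁻¹ * a.perm

/-- `f ≫ g` is the composition `g · f`, given by the product `ou g * ou f` of braids. -/
instance (n : ℕ) : Groupoid (PaB n) where
  Hom := PaBHom
  id a := ⟨1, by simp⟩
  comp f g := ⟨g.ou * f.ou, by rw [map_mul, g.rho_ou, f.rho_ou]; group⟩
  inv f := ⟨f.ou⁻¹, by rw [map_inv, f.rho_ou]; group⟩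
  id_comp f := PaBHom.ext (mul_one _)
  comp_id f := PaBHom.ext (one_mul _)
  assoc f g h := PaBHom.ext (mul_assoc _ _ _).symm
  inv_comp f := PaBHom.ext (mul_inv_cancel _)
  comp_inv f := PaBHom.ext (inv_mul_cancel _)

/-- Substitution of the parenthesized word `s` in place of the letter of `t` at position `p`. -/
def graft : FreeMagma Unit → ℕ → FreeMagma Unit → FreeMagma Unit
  | .of _, _, s => s
  | .mul l r, p, s =>
    if p < l.length then .mul (graft l p s) r else .mul l (graft r (p - l.length) s)

theorem length_graft (t : FreeMagma Unit) (p : ℕ) (s : FreeMagma Unit) (hp : p < t.length) :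
    (graft t p s).length + 1 = t.length + s.length := by
  induction t generalizing p with
  | ih1 _ => simp [graft, FreeMagma.length]; omega
  | ih2 l r hl hr =>
    change p < l.length + r.length at hp
    change _ = l.length + r.length + _
    by_cases h : p < l.length
    · have := hl p h
      simp only [graft, h, if_true]
      change (graft l p s).length + r.length + 1 = _
      omega
    · have := hr (p - l.length) (by omega)
      simp only [graft, h, if_false]
      change l.length + (graft r (p - l.length) s).length + 1 = _
      omega

namespace PaB

/-- The action of the symmetric group on `PaB(n)`: it changes the labels and keeps the braids. -/
def act {n : ℕ} (θ : Equiv.Perm (Fin n)) : PaB n ⥤ PaB n where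
  obj a := ⟨a.shape, a.length_shape, θ * a.perm⟩
  map f := ⟨f.ou, by rw [f.rho_ou]; simp [mul_assoc]⟩

/-- The insertion of objects: the letter with label `i` of `a` is replaced by `b`. -/
def insObj {n m k : ℕ} (hk : n + m = k + 1) (i : Fin n) (a : PaB n) (b : PaB m) : PaB k where
  shape := graft a.shape (a.perm⁻¹ i : Fin n) b.shape
  length_shape := by
    have := length_graft a.shape (a.perm⁻¹ i : Fin n) b.shape (by rw [a.length_shape]; omega)
    rw [a.length_shape, b.length_shape] at this
    omega
  perm := insPerm hk a.perm b.perm (a.perm⁻¹ i)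

/-- The elementary insertion `∘_{i+1} : PaB(n) × PaB(m) → PaB(k)`, where `k = n + m - 1`. -/
def ins {n m k : ℕ} (hk : n + m = k + 1) (i : Fin n) : PaB n × PaB m ⥤ PaB k where
  obj x := insObj hk i x.1 x.2
  map {x y} f := ⟨Braid.insert hk f.1.ou f.2.ou (x.1.perm⁻¹ i), by
    have h1 := f.1.rho_ou
    have h2 := f.2.rho_ou
    rw [Braid.rho_insert, eq_inv_mul_iff_mul_eq]
    change insPerm hk y.1.perm y.2.perm (y.1.perm⁻¹ i) * _ = insPerm hk x.1.perm x.2.perm _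
    have h3 : y.1.perm⁻¹ i = Braid.rho n f.1.ou (x.1.perm⁻¹ i) := by rw [h1]; simp
    rw [h3, ← insPerm_mul, h1, h2]
    simp⟩
  map_id x := PaBHom.ext (Braid.insert_one hk _)
  map_comp {x y z} f g := PaBHom.ext (by
    have h1 := f.1.rho_ou
    have h3 : y.1.perm⁻¹ i = Braid.rho n f.1.ou (x.1.perm⁻¹ i) := by rw [h1]; simp
    change Braid.insert hk (g.1.ou * f.1.ou) (g.2.ou * f.2.ou) _ =
      Braid.insert hk g.1.ou g.2.ou _ * Braid.insert hk f.1.ou f.2.ou _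
    rw [Braid.insert_mul, h3])

end PaB

/-- A compatible equivalence relation on a groupoid with finitely many objects: an
equivalence relation on morphisms with the same source and target, compatible with composition and
with finitely many classes. -/
structure FinCong (C : Type*) [Category C] where
  rel : ∀ a b : C, Setoid (a ⟶ b)
  comp : ∀ {a b c : C} {f f' : a ⟶ b} {g g' : b ⟶ c},
    (rel a b).r f f' → (rel b c).r g g' → (rel a c).r (f ≫ g) (f' ≫ g')
  finite : ∀ a b : C, Finite (Quotient (rel a b))

namespace FinCong

variable {C D : Type*} [Category C] [Category D]

/-- `R.Finer S`: equivalence with respect to `R` implies equivalence with respect to `S`. -/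
def Finer (R S : FinCong C) : Prop :=
  ∀ (a b : C) (f f' : a ⟶ b), (R.rel a b).r f f' → (S.rel a b).r f f'

/-- The morphisms of the quotient groupoid. -/
abbrev QuotHom (R : FinCong C) (a b : C) : Type _ := Quotient (R.rel a b)

/-- The composition in the quotient groupoid. -/
def quotComp (R : FinCong C) {a b c : C} (x : R.QuotHom a b) (y : R.QuotHom b c) :
    R.QuotHom a c :=
  Quotient.map₂ (fun f g => f ≫ g) (fun _ _ h _ _ h' => R.comp h h') x y

/-- The inverse image of a compatible equivalence relation under a functor. -/
def comap (F : C ⥤ D) (R : FinCong D) : FinCong C where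
  rel a b := (R.rel (F.obj a) (F.obj b)).comap F.map
  comp h h' := by
    simp only [Setoid.comap_rel, Functor.map_comp] at *
    exact R.comp h h'
  finite a b := by
    have := R.finite (F.obj a) (F.obj b)
    refine Finite.of_injective
      (Quotient.map (sa := (R.rel (F.obj a) (F.obj b)).comap F.map)
        (sb := R.rel (F.obj a) (F.obj b)) F.map fun _ _ h => h) ?_
    rintro ⟨f⟩ ⟨g⟩ h
    exact Quotient.sound (s := (R.rel (F.obj a) (F.obj b)).comap F.map)
      (Quotient.exact (s := R.rel (F.obj a) (F.obj b)) h)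

end FinCong

/-- Morphisms of the profinite completion of a groupoid: the limit of the morphisms of the quotient
groupoids over all compatible equivalence relations. -/
@[ext] structure HatHom {C : Type*} [Category C] (a b : C) where
  val : ∀ R : FinCong C, R.QuotHom a b
  compat : ∀ R S : FinCong C, R.Finer S → ∀ f : a ⟶ b, val R = ⟦f⟧ → val S = ⟦f⟧

namespace HatHom

variable {C D E : Type*} [Category C] [Category D] [Category E]

/-- The limit topology, all the finite sets of classes being discrete. -/
instance (a b : C) : TopologicalSpace (HatHom a b) :=
  TopologicalSpace.induced HatHom.val
    (@Pi.topologicalSpace (FinCong C) (fun R => R.QuotHom a b) (fun _ => ⊥))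

/-- The canonical map to the completion. -/
def incl {a b : C} (f : a ⟶ b) : HatHom a b where
  val _ := ⟦f⟧
  compat _ _ h _ hg := Quotient.sound (h _ _ _ _ (Quotient.exact hg))

/-- The composition in the completion. -/
def comp {a b c : C} (x : HatHom a b) (y : HatHom b c) : HatHom a c where
  val R := R.quotComp (x.val R) (y.val R)
  compat R S h f hf := by
    obtain ⟨f₁, h₁⟩ := Quotient.exists_rep (x.val R)
    obtain ⟨f₂, h₂⟩ := Quotient.exists_rep (y.val R)
    rw [x.compat R S h f₁ h₁.symm, y.compat R S h f₂ h₂.symm]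
    rw [← h₁, ← h₂] at hf
    exact Quotient.sound (h _ _ _ _ (Quotient.exact hf))

/-- The map of completions induced by a functor. -/
def map (F : C ⥤ D) {a b : C} (x : HatHom a b) : HatHom (F.obj a) (F.obj b) where
  val R := Quotient.map F.map (fun _ _ h => h) (x.val (R.comap F))
  compat R S h f hf := by
    obtain ⟨g, hg⟩ := Quotient.exists_rep (x.val (R.comap F))
    rw [x.compat (R.comap F) (S.comap F) (fun _ _ _ _ h' => h _ _ _ _ h') g hg.symm]
    rw [← hg] at hf
    exact Quotient.sound (h _ _ _ _ (Quotient.exact hf))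

/-- The map of completions induced by a functor of two variables. -/
def map₂ (F : C × D ⥤ E) {a a' : C} {b b' : D} (x : HatHom a a') (y : HatHom b b') :
    HatHom (F.obj (a, b)) (F.obj (a', b')) :=
  comp (map (Prod.sectR a D ⋙ F) y) (map (Prod.sectL C b' ⋙ F) x)

end HatHom

/-- A continuous automorphism of the operad `PaB^` (the profinite completion of `PaB`), acting as
the identity on objects. -/
structure PaBHatAut where
  map : ∀ {n : ℕ} {a b : PaB n}, HatHom a b ≃ₜ HatHom a b
  map_id : ∀ {n : ℕ} (a : PaB n), map (HatHom.incl (𝟙 a)) = HatHom.incl (𝟙 a)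
  map_comp : ∀ {n : ℕ} {a b c : PaB n} (x : HatHom a b) (y : HatHom b c),
    map (x.comp y) = (map x).comp (map y)
  map_act : ∀ {n : ℕ} (θ : Equiv.Perm (Fin n)) {a b : PaB n} (x : HatHom a b),
    map (x.map (PaB.act θ)) = (map x).map (PaB.act θ)
  map_ins : ∀ {n m k : ℕ} (hk : n + m = k + 1) (i : Fin n) {a a' : PaB n} {b b' : PaB m}
    (x : HatHom a a') (y : HatHom b b'),
    map (HatHom.map₂ (PaB.ins hk i) x y) = HatHom.map₂ (PaB.ins hk i) (map x) (map y)

namespace PaB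

/-- The braid of an endomorphism, as a pure braid. -/
def ouPure {n : ℕ} {a : PaB n} (f : a ⟶ a) : PB n :=
  ⟨f.ou, by rw [MonoidHom.mem_ker, f.rho_ou, inv_mul_cancel]⟩

/-- The parenthesization `(..(· ·)·)..·)` of a word of length `n + 1`. -/
def leftComb : ℕ → FreeMagma Unit
  | 0 => .of ()
  | n + 1 => .mul (leftComb n) (.of ())

theorem length_leftComb (n : ℕ) : (leftComb n).length = n + 1 := by
  induction n with
  | zero => rfl
  | succ n ih =>
    change (leftComb n).length + 1 = _
    rw [ih]

/-- The object `(..((1 2) 3)..n+1)` of `PaB(n + 1)`. -/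
def std (n : ℕ) : PaB (n + 1) := ⟨leftComb n, length_leftComb n, 1⟩

/-- A pure braid, as an automorphism of the standard object. -/
def mm {n : ℕ} (h : PB (n + 1)) : std n ⟶ std n :=
  ⟨h, by rw [inv_mul_cancel]; exact h.2⟩

theorem mm_mul {n : ℕ} (h h' : PB (n + 1)) : mm (h * h') = mm h' ≫ mm h := rfl

/-- The homomorphisms `h ↦ ou (id₁₂ ∘_{q+1} m(h))`. -/
def cofaceOuter (n : ℕ) (q : Fin 2) : PB (n + 1) →* PB (n + 2) where
  toFun h := ouPure ((ins (show 2 + (n + 1) = n + 2 + 1 by omega) q).map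
    (X := (std 1, std n)) (Y := (std 1, std n)) (𝟙 (std 1), mm h))
  map_one' := by
    apply Subtype.ext
    exact Braid.insert_one (show 2 + (n + 1) = n + 2 + 1 by omega) q
  map_mul' h h' := by
    apply Subtype.ext
    exact Braid.insert_mul (show 2 + (n + 1) = n + 2 + 1 by omega) 1 1 h h' q

/-- The homomorphisms `h ↦ ou (m(h) ∘_{p+1} id₁₂)`. -/
def cofaceInner (n : ℕ) (p : Fin (n + 1)) : PB (n + 1) →* PB (n + 2) where
  toFun h := ouPure ((ins (show n + 1 + 2 = n + 2 + 1 by omega) p).map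
    (X := (std n, std 1)) (Y := (std n, std 1)) (mm h, 𝟙 (std 1)))
  map_one' := by
    apply Subtype.ext
    exact Braid.insert_one (show n + 1 + 2 = n + 2 + 1 by omega) p
  map_mul' h h' := by
    apply Subtype.ext
    have := Braid.insert_mul (show n + 1 + 2 = n + 2 + 1 by omega) (h : Braid (n + 1)) h' 1 1 p
    rw [show Braid.rho (n + 1) h' = 1 from h'.2] at this
    exact this

end PaB

/-- The preimage of a subgroup of `PB(n + 2)` under all the cofaces `PB(n + 1) → PB(n + 2)`. -/
def cofacePreimage {n : ℕ} (M : Subgroup (PB (n + 2))) : Subgroup (PB (n + 1)) :=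
  (⨅ q : Fin 2, M.comap (PaB.cofaceOuter n q)) ⊓ ⨅ p : Fin (n + 1), M.comap (PaB.cofaceInner n p)

/-- The poset of normal subgroups of finite index of `B₄` that are contained in `PB₄`. -/
structure NFI where
  N : Subgroup (Braid 4)
  normal : N.Normal
  finiteIndex : N.FiniteIndex
  le_PB : N ≤ PB 4

/-- The subgroups `N_{PB₂}`, `N_{PB₃}` and `N_{PB₄} = N` (and, in the other arities, the whole
group; it is trivial in arity `1`). -/
def NFI.sub (K : NFI) : ∀ n : ℕ, Subgroup (PB n)
  | 2 => cofacePreimage (cofacePreimage (K.N.subgroupOf (PB 4)))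
  | 3 => cofacePreimage (K.N.subgroupOf (PB 4))
  | 4 => K.N.subgroupOf (PB 4)
  | _ => ⊤

namespace NFI

open Braid

theorem mem_cofacePreimage {n : ℕ} {M : Subgroup (PB (n + 2))} {h : PB (n + 1)} :
    h ∈ cofacePreimage M ↔
      (∀ q : Fin 2, PaB.cofaceOuter n q h ∈ M) ∧ ∀ p : Fin (n + 1), PaB.cofaceInner n p h ∈ M := by
  simp [cofacePreimage, Subgroup.mem_iInf]

theorem cofaceOuter_coe {n : ℕ} (q : Fin 2) (h : PB (n + 1)) :
    (PaB.cofaceOuter n q h : Braid (n + 2)) = shift (n + 1) (n + 2) q (by omega) h := by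
  change Braid.insert (show 2 + (n + 1) = n + 2 + 1 by omega) 1 (h : Braid (n + 1)) q = _
  rw [Braid.insert, cable_one, one_mul]

theorem cofaceInner_coe {n : ℕ} (p : Fin (n + 1)) (h : PB (n + 1)) :
    (PaB.cofaceInner n p h : Braid (n + 2)) = cable (show n + 1 + 2 = n + 2 + 1 by omega) h p := by
  change Braid.insert (show n + 1 + 2 = n + 2 + 1 by omega) (h : Braid (n + 1)) 1 p = _
  rw [Braid.insert, map_one, mul_one]

/-- Conjugation of pure braids by braids. -/
def conj {n : ℕ} (g : Braid n) (h : PB n) : PB n := MulAut.conjNormal g h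

theorem conj_coe {n : ℕ} (g : Braid n) (h : PB n) : (conj g h : Braid n) = g * h * g⁻¹ := rfl

theorem conj_mem_cofacePreimage {n : ℕ} {M : Subgroup (PB (n + 2))}
    (hM : ∀ (g : Braid (n + 2)) (h : PB (n + 2)), h ∈ M → conj g h ∈ M)
    (g : Braid (n + 1)) (h : PB (n + 1)) (hh : h ∈ cofacePreimage M) :
    conj g h ∈ cofacePreimage M := by
  rw [mem_cofacePreimage] at *
  constructor
  · intro q
    convert hM (shift (n + 1) (n + 2) q (by omega) g) _ (hh.1 q) using 1
    apply Subtype.ext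
    rw [cofaceOuter_coe, conj_coe, conj_coe, cofaceOuter_coe, map_mul, map_mul, map_inv]
  · intro p
    convert hM (cable (show n + 1 + 2 = n + 2 + 1 by omega) g ((rho (n + 1) g)⁻¹ p)) _
      (hh.2 ((rho (n + 1) g)⁻¹ p)) using 1
    apply Subtype.ext
    have h1 : rho (n + 1) (h : Braid (n + 1)) = 1 := h.2
    rw [cofaceInner_coe, conj_coe, conj_coe, cofaceInner_coe, cable_mul, cable_mul, cable_inv,
      map_inv, h1]
    rfl

theorem conj_mem_four (K : NFI) (g : Braid 4) (h : PB 4) (hh : h ∈ K.N.subgroupOf (PB 4)) :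
    conj g h ∈ K.N.subgroupOf (PB 4) :=
  K.normal.conj_mem _ hh g

theorem conj_mem (K : NFI) : ∀ {n : ℕ} (g : Braid n) (h : PB n), h ∈ K.sub n → conj g h ∈ K.sub n
  | 2, g, h, hh =>
    conj_mem_cofacePreimage (conj_mem_cofacePreimage K.conj_mem_four) g h hh
  | 3, g, h, hh => conj_mem_cofacePreimage K.conj_mem_four g h hh
  | 4, g, h, hh => K.conj_mem_four g h hh
  | 0, _, _, _ => trivial
  | 1, _, _, _ => trivial
  | _ + 5, _, _, _ => trivial

instance sub_normal (K : NFI) (n : ℕ) : (K.sub n).Normal where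
  conj_mem h hh g := by
    have := K.conj_mem (g : Braid n) h hh
    exact this

theorem finiteIndex_comap {G H : Type*} [Group G] [Group H] (f : G →* H) (M : Subgroup H)
    [M.FiniteIndex] : (M.comap f).FiniteIndex :=
  ⟨by rw [Subgroup.index_comap]; exact (Subgroup.instFiniteIndex_subgroupOf M f.range).index_ne_zero⟩

theorem finiteIndex_cofacePreimage {n : ℕ} {M : Subgroup (PB (n + 2))} (hM : M.FiniteIndex) :
    (cofacePreimage M).FiniteIndex := by
  have h1 : (⨅ q : Fin 2, M.comap (PaB.cofaceOuter n q)).FiniteIndex :=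
    Subgroup.finiteIndex_iInf fun _ => finiteIndex_comap _ _
  have h2 : (⨅ p : Fin (n + 1), M.comap (PaB.cofaceInner n p)).FiniteIndex :=
    Subgroup.finiteIndex_iInf fun _ => finiteIndex_comap _ _
  unfold cofacePreimage
  infer_instance

theorem sub_finiteIndex (K : NFI) (n : ℕ) : (K.sub n).FiniteIndex := by
  have h4 : (K.N.subgroupOf (PB 4)).FiniteIndex := by
    have := K.finiteIndex
    infer_instance
  have h3 := finiteIndex_cofacePreimage h4
  match n with
  | 2 => exact finiteIndex_cofacePreimage h3
  | 3 => exact h3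
  | 4 => exact h4
  | 0 => change (⊤ : Subgroup _).FiniteIndex; infer_instance
  | 1 => change (⊤ : Subgroup _).FiniteIndex; infer_instance
  | _ + 5 => change (⊤ : Subgroup _).FiniteIndex; infer_instance

/-- The equivalence relation `∼_N` on the morphisms of `PaB(n)`: `γ ∼ γ'` if and only if
`ou (γ⁻¹ · γ')` lies in `N_{PB_n}`. -/
def sim (K : NFI) (n : ℕ) : FinCong (PaB n) where
  rel a b :=
    { r := fun γ γ' => PaB.ouPure (γ' ≫ Groupoid.inv γ) ∈ K.sub n
      iseqv :=
        { refl := fun γ => by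
            have : PaB.ouPure (γ ≫ Groupoid.inv γ) = 1 :=
              Subtype.ext (inv_mul_cancel γ.ou)
            rw [this]; exact one_mem _
          symm := fun {γ γ'} h => by
            have : PaB.ouPure (γ ≫ Groupoid.inv γ') = (PaB.ouPure (γ' ≫ Groupoid.inv γ))⁻¹ :=
              Subtype.ext (show γ'.ou⁻¹ * γ.ou = (γ.ou⁻¹ * γ'.ou)⁻¹ by group)
            rw [this]; exact inv_mem h
          trans := fun {γ γ' γ''} h h' => by
            have : PaB.ouPure (γ'' ≫ Groupoid.inv γ) =
                PaB.ouPure (γ' ≫ Groupoid.inv γ) * PaB.ouPure (γ'' ≫ Groupoid.inv γ') :=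
              Subtype.ext (show γ.ou⁻¹ * γ''.ou = γ.ou⁻¹ * γ'.ou * (γ'.ou⁻¹ * γ''.ou) by group)
            rw [this]; exact mul_mem h h' } }
  comp {a b c f f' g g'} h h' := by
    have : PaB.ouPure ((f' ≫ g') ≫ Groupoid.inv (f ≫ g)) =
        conj f.ou⁻¹ (PaB.ouPure (g' ≫ Groupoid.inv g)) * PaB.ouPure (f' ≫ Groupoid.inv f) :=
      Subtype.ext (show (g.ou * f.ou)⁻¹ * (g'.ou * f'.ou) =
        f.ou⁻¹ * (g.ou⁻¹ * g'.ou) * f.ou⁻¹⁻¹ * (f.ou⁻¹ * f'.ou) by group)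
    change PaB.ouPure ((f' ≫ g') ≫ Groupoid.inv (f ≫ g)) ∈ K.sub n
    rw [this]
    exact mul_mem (K.conj_mem _ _ h') h
  finite a b := by
    have := K.sub_finiteIndex n
    by_cases hne : Nonempty (a ⟶ b)
    · obtain ⟨f₀⟩ := hne
      refine Finite.of_surjective (α := PB n ⧸ K.sub n) (Quotient.map
        (fun h : PB n => (⟨f₀.ou * h, by
          rw [map_mul, show rho n (h : Braid n) = 1 from h.2, mul_one]; exact f₀.rho_ou⟩ :
            PaBHom a b)) ?_) ?_
      · intro h h' hr
        have hr' : h⁻¹ * h' ∈ K.sub n := QuotientGroup.leftRel_apply.mp hr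
        have e : h⁻¹ * h' = PaB.ouPure (a := a) (⟨(f₀.ou * (h : Braid n))⁻¹ * (f₀.ou * h'), by
            rw [map_mul, map_inv, map_mul, map_mul, show rho n (h : Braid n) = 1 from h.2,
              show rho n (h' : Braid n) = 1 from h'.2]
            simp⟩ : PaBHom a a) :=
          Subtype.ext (show (h : Braid n)⁻¹ * h' = (f₀.ou * (h : Braid n))⁻¹ * (f₀.ou * h') by
            group)
        rw [e] at hr'
        exact hr'
      · rintro ⟨f⟩
        refine ⟨QuotientGroup.mk (PaB.ouPure (f ≫ Groupoid.inv f₀)), ?_⟩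
        refine congrArg (Quot.mk _) (PaBHom.ext ?_)
        exact (show f₀.ou * (f₀.ou⁻¹ * f.ou) = f.ou by group)
    · have : IsEmpty (a ⟶ b) := not_nonempty_iff.mp hne
      exact Finite.of_surjective (Quot.mk _ : (a ⟶ b) → _) Quot.mk_surjective

/-- The subgroup `N_{PB_n}`, regarded as a subgroup of the braid group. -/
def subB (K : NFI) (n : ℕ) : Subgroup (Braid n) := (K.sub n).map (PB n).subtype

theorem mem_subB {K : NFI} {n : ℕ} {x : Braid n} :
    x ∈ K.subB n ↔ ∃ h : x ∈ PB n, (⟨x, h⟩ : PB n) ∈ K.sub n := by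
  simp [subB]

theorem mem_subB_of_trivial {K : NFI} {n : ℕ} (hn : K.sub n = ⊤) {x : Braid n} (hx : x ∈ PB n) :
    x ∈ K.subB n :=
  mem_subB.mpr ⟨hx, by rw [hn]; trivial⟩

theorem braid_one_eq (x : Braid 1) : x = 1 := by
  induction x using Braid.induction with
  | h1 => rfl
  | hg i => exact i.elim0
  | hm x y hx hy => rw [hx, hy, mul_one]
  | hi x hx => rw [hx, inv_one]

theorem cable_m_one {n : ℕ} (hk : n + 1 = n + 1) (g : Braid n) (p : Fin n) : cable hk g p = g := by
  induction g using Braid.induction generalizing p with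
  | h1 => simp
  | hg i =>
    rw [cable_of, ← sig_of, cableGen]
    split_ifs <;> simp [strandOver, blockOver]
  | hm x y hx hy => rw [cable_mul, hx, hy]
  | hi x hx => rw [cable_inv, hx]

theorem shift_self {m : ℕ} (h : 0 + m ≤ m) (g : Braid m) : shift m m 0 h g = g := by
  have : shift m m 0 h = MonoidHom.id _ := PresentedGroup.ext fun j => by simp [sig_of]
  rw [this]; rfl

theorem shift_shift {m k l a b : ℕ} (h : a + m ≤ k) (h' : b + k ≤ l) (g : Braid m) :
    shift k l b h' (shift m k a h g) = shift m l (b + a) (by omega) g := by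
  have : (shift k l b h').comp (shift m k a h) = shift m l (b + a) (by omega) :=
    PresentedGroup.ext fun j => by
      have hj : a + (j : ℕ) < k - 1 := by omega
      simp only [MonoidHom.comp_apply, shift_of]
      rw [show sig k (a + j) = PresentedGroup.of ⟨a + j, hj⟩ from sig_of ⟨a + j, hj⟩, shift_of,
        add_assoc]
  exact DFunLike.congr_fun this g

theorem cable_cable (g : Braid 2) (p : Fin 2) :
    cable (show 3 + 2 = 4 + 1 from rfl) (cable (show 2 + 2 = 3 + 1 from rfl) g p)
      (blockEquiv (show 2 + 2 = 3 + 1 from rfl) p (.inr 0)) =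
    cable (show 2 + 3 = 4 + 1 from rfl) g p := by
  have key : ∀ (g : Braid 2) (p : Fin 2), rho 3 (cable (show 2 + 2 = 3 + 1 from rfl) g p)
      (blockEquiv (show 2 + 2 = 3 + 1 from rfl) p (.inr 0)) =
      blockEquiv (show 2 + 2 = 3 + 1 from rfl) (rho 2 g p) (.inr 0) := by
    intro g p
    rw [rho_cable, insPerm_inr]; rfl
  induction g using Braid.induction generalizing p with
  | h1 => simp
  | hg i =>
    obtain rfl : i = ⟨0, by decide⟩ := Fin.ext (by omega)
    have e0 : (PresentedGroup.of (⟨0, by decide⟩ : Fin (3 - 1)) : Braid 3) = sig 3 0 :=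
      (sig_of (n := 3) ⟨0, by decide⟩).symm
    have e1 : (PresentedGroup.of (⟨1, by decide⟩ : Fin (3 - 1)) : Braid 3) = sig 3 1 :=
      (sig_of (n := 3) ⟨1, by decide⟩).symm
    rcases p with ⟨p, hp⟩
    obtain rfl | rfl : p = 0 ∨ p = 1 := by omega
    · have h1 : cable (show 2 + 2 = 3 + 1 from rfl)
          (PresentedGroup.of (⟨0, by decide⟩ : Fin (2 - 1))) (⟨0, hp⟩ : Fin 2) =
            sig 3 0 * sig 3 1 := by
        rw [cable_of, adjSwap_val]; simp [cableGen, blockOver]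
      have h2 : cable (show 2 + 3 = 4 + 1 from rfl)
          (PresentedGroup.of (⟨0, by decide⟩ : Fin (2 - 1))) (⟨0, hp⟩ : Fin 2) =
            sig 4 0 * sig 4 1 * sig 4 2 := by
        rw [cable_of, adjSwap_val]; simp [cableGen, blockOver]
      have h3 : blockEquiv (show 2 + 2 = 3 + 1 from rfl) (⟨0, hp⟩ : Fin 2) (.inr 0) =
        (⟨0, by decide⟩ : Fin 3) := rfl
      rw [h1, h2, h3, ← e0, ← e1, cable_mul, cable_of, cable_of, adjSwap_val, adjSwap_val, rho_of,
        adjSwap_val]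
      simp [cableGen, blockOver]
    · have h1 : cable (show 2 + 2 = 3 + 1 from rfl)
          (PresentedGroup.of (⟨0, by decide⟩ : Fin (2 - 1))) (⟨1, hp⟩ : Fin 2) =
            sig 3 1 * sig 3 0 := by
        rw [cable_of, adjSwap_val]; simp [cableGen, strandOver]
      have h2 : cable (show 2 + 3 = 4 + 1 from rfl)
          (PresentedGroup.of (⟨0, by decide⟩ : Fin (2 - 1))) (⟨1, hp⟩ : Fin 2) =
            sig 4 2 * (sig 4 1 * sig 4 0) := by
        rw [cable_of, adjSwap_val]; simp [cableGen, strandOver]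
      have h3 : blockEquiv (show 2 + 2 = 3 + 1 from rfl) (⟨1, hp⟩ : Fin 2) (.inr 0) =
        (⟨1, by decide⟩ : Fin 3) := rfl
      rw [h1, h2, h3, ← e0, ← e1, cable_mul, cable_of, cable_of, adjSwap_val, adjSwap_val, rho_of,
        adjSwap_val]
      simp [cableGen, strandOver]
  | hm x y hx hy =>
    rw [cable_mul, cable_mul, cable_mul, key, hx, hy]
  | hi x hx =>
    rw [cable_inv, cable_inv, cable_inv, ← hx]
    congr 2
    rw [Equiv.Perm.inv_eq_iff_eq, key]
    rw [show rho 2 x ((rho 2 x)⁻¹ p) = p from Equiv.apply_symm_apply (rho 2 x) p]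

theorem cable_mem_two (K : NFI) {x : Braid 2} (hx : x ∈ K.subB 2) (p : Fin 2) :
    cable (show 2 + 2 = 3 + 1 from rfl) x p ∈ K.subB 3 := by
  obtain ⟨h, hx⟩ := mem_subB.mp hx
  have := (mem_cofacePreimage.mp hx).2 p
  rw [← show _ = cable (show 2 + 2 = 3 + 1 from rfl) x p from cofaceInner_coe p ⟨x, h⟩]
  exact ⟨_, this, rfl⟩

theorem cable_mem_three (K : NFI) {x : Braid 3} (hx : x ∈ K.subB 3) (p : Fin 3) :
    cable (show 3 + 2 = 4 + 1 from rfl) x p ∈ K.subB 4 := by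
  obtain ⟨h, hx⟩ := mem_subB.mp hx
  have := (mem_cofacePreimage.mp hx).2 p
  rw [← show _ = cable (show 3 + 2 = 4 + 1 from rfl) x p from cofaceInner_coe p ⟨x, h⟩]
  exact ⟨_, this, rfl⟩

theorem shift_mem_two (K : NFI) {x : Braid 2} (hx : x ∈ K.subB 2) (q : ℕ) (hq : q + 2 ≤ 3) :
    shift 2 3 q hq x ∈ K.subB 3 := by
  obtain ⟨h, hx⟩ := mem_subB.mp hx
  have := (mem_cofacePreimage.mp hx).1 ⟨q, by omega⟩
  rw [← show _ = shift 2 3 q hq x from cofaceOuter_coe ⟨q, by omega⟩ ⟨x, h⟩]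
  exact ⟨_, this, rfl⟩

theorem shift_mem_three (K : NFI) {x : Braid 3} (hx : x ∈ K.subB 3) (q : ℕ) (hq : q + 3 ≤ 4) :
    shift 3 4 q hq x ∈ K.subB 4 := by
  obtain ⟨h, hx⟩ := mem_subB.mp hx
  have := (mem_cofacePreimage.mp hx).1 ⟨q, by omega⟩
  rw [← show _ = shift 3 4 q hq x from cofaceOuter_coe ⟨q, by omega⟩ ⟨x, h⟩]
  exact ⟨_, this, rfl⟩

theorem cable_mem (K : NFI) {n m k : ℕ} (hk : n + m = k + 1) (hm : 0 < m) {x : Braid n}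
    (hx : x ∈ K.subB n) (p : Fin n) : cable hk x p ∈ K.subB k := by
  have hP : cable hk x p ∈ PB k := by
    obtain ⟨h, -⟩ := mem_subB.mp hx
    rw [MonoidHom.mem_ker, rho_cable, show rho n x = 1 from h, insPerm_one]
  obtain rfl | hm1 := eq_or_ne m 1
  · obtain rfl : n = k := by omega
    rw [cable_m_one]; exact hx
  obtain rfl | hn1 := eq_or_ne n 1
  · rw [braid_one_eq x, cable_one]; exact one_mem _
  have hn := p.2
  match k, hk with
  | 0, _ => exact mem_subB_of_trivial rfl hP
  | 1, _ => exact mem_subB_of_trivial rfl hP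
  | 2, _ => omega
  | 3, hk =>
    obtain rfl : n = 2 := by omega
    obtain rfl : m = 2 := by omega
    exact K.cable_mem_two hx p
  | 4, hk =>
    obtain rfl | rfl : n = 2 ∨ n = 3 := by omega
    · obtain rfl : m = 3 := by omega
      rw [← cable_cable]
      exact K.cable_mem_three (K.cable_mem_two hx p) _
    · obtain rfl : m = 2 := by omega
      exact K.cable_mem_three hx p
  | _ + 5, _ => exact mem_subB_of_trivial rfl hP

theorem shift_mem (K : NFI) {n m k : ℕ} (hk : n + m = k + 1) (hm : 0 < m) {x : Braid m}
    (hx : x ∈ K.subB m) (p : Fin n) : shift m k p (by omega) x ∈ K.subB k := by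
  have hP : shift m k p (by omega) x ∈ PB k := by
    obtain ⟨h, -⟩ := mem_subB.mp hx
    rw [MonoidHom.mem_ker, rho_shift hk, show rho m x = 1 from h, insPerm_one]
  have hn := p.2
  obtain rfl | hn1 := eq_or_ne n 1
  · obtain rfl : m = k := by omega
    have : (p : ℕ) = 0 := by omega
    simp only [this]
    rw [shift_self]; exact hx
  obtain rfl | hm1 := eq_or_ne m 1
  · rw [braid_one_eq x, map_one]; exact one_mem _
  revert hP
  match k, hk with
  | 0, _ => intro hP; exact mem_subB_of_trivial rfl hP
  | 1, _ => intro hP; exact mem_subB_of_trivial rfl hP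
  | 2, _ => omega
  | 3, hk =>
    intro _
    obtain rfl : n = 2 := by omega
    obtain rfl : m = 2 := by omega
    exact K.shift_mem_two hx _ _
  | 4, hk =>
    intro _
    obtain rfl | rfl : n = 2 ∨ n = 3 := by omega
    · obtain rfl : m = 3 := by omega
      exact K.shift_mem_three hx _ _
    · obtain rfl : m = 2 := by omega
      rcases p with ⟨p, hp⟩
      by_cases h0 : p = 0
      · subst h0
        have := K.shift_mem_three (K.shift_mem_two hx 0 (by omega)) 0 (by omega)
        rwa [shift_shift] at this
      · have := K.shift_mem_three (K.shift_mem_two hx (p - 1) (by omega)) 1 (by omega)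
        rw [shift_shift] at this
        simpa only [show 1 + (p - 1) = p by omega] using this
  | _ + 5, _ => intro hP; exact mem_subB_of_trivial rfl hP

theorem sim_iff {K : NFI} {n : ℕ} {a b : PaB n} {f f' : a ⟶ b} :
    ((K.sim n).rel a b).r f f' ↔ f.ou⁻¹ * f'.ou ∈ K.subB n := by
  rw [mem_subB]
  exact ⟨fun h => ⟨_, h⟩, fun ⟨_, h⟩ => h⟩

theorem sim_ins (K : NFI) {n m k : ℕ} (hk : n + m = k + 1) (i : Fin n) {a a' : PaB n}
    {b b' : PaB m} {f f' : a ⟶ a'} {g g' : b ⟶ b'} (hf : ((K.sim n).rel a a').r f f')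
    (hg : ((K.sim m).rel b b').r g g') :
    ((K.sim k).rel _ _).r ((PaB.ins hk i).map (X := (a, b)) (Y := (a', b')) (f, g))
      ((PaB.ins hk i).map (X := (a, b)) (Y := (a', b')) (f', g')) := by
  rw [sim_iff] at *
  change (Braid.insert hk f.ou g.ou (a.perm⁻¹ i))⁻¹ * Braid.insert hk f'.ou g'.ou (a.perm⁻¹ i) ∈ _
  have e : Braid.insert hk f'.ou g'.ou (a.perm⁻¹ i) = Braid.insert hk f.ou g.ou (a.perm⁻¹ i) *
      Braid.insert hk (f.ou⁻¹ * f'.ou) (g.ou⁻¹ * g'.ou) (a.perm⁻¹ i) := by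
    have h := Braid.insert_mul hk f.ou (f.ou⁻¹ * f'.ou) g.ou (g.ou⁻¹ * g'.ou) (a.perm⁻¹ i)
    have h1 : rho n (f.ou⁻¹ * f'.ou) = 1 := by
      rw [map_mul, map_inv, f.rho_ou, f'.rho_ou, inv_mul_cancel]
    rwa [mul_inv_cancel_left, mul_inv_cancel_left, h1, Equiv.Perm.one_apply] at h
  rw [e, inv_mul_cancel_left]
  have hm : 0 < m := by rw [← b.length_shape]; exact b.shape.length_pos
  exact mul_mem (K.cable_mem hk hm hf _) (K.shift_mem hk hm hg _)

theorem sim_act (K : NFI) {n : ℕ} (θ : Equiv.Perm (Fin n)) {a a' : PaB n} {f f' : a ⟶ a'}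
    (hf : ((K.sim n).rel a a').r f f') :
    ((K.sim n).rel _ _).r ((PaB.act θ).map f) ((PaB.act θ).map f') := by
  rw [sim_iff] at *
  exact hf

/-- The action of the symmetric group on the quotient `PaB / ∼_N`. -/
def quotAct (K : NFI) {n : ℕ} (θ : Equiv.Perm (Fin n)) {a a' : PaB n}
    (x : (K.sim n).QuotHom a a') :
    (K.sim n).QuotHom ((PaB.act θ).obj a) ((PaB.act θ).obj a') :=
  Quotient.map (PaB.act θ).map (fun _ _ h => K.sim_act θ h) x

/-- The elementary insertions of the quotient `PaB / ∼_N`. -/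
def quotIns (K : NFI) {n m k : ℕ} (hk : n + m = k + 1) (i : Fin n) {a a' : PaB n} {b b' : PaB m}
    (x : (K.sim n).QuotHom a a') (y : (K.sim m).QuotHom b b') :
    (K.sim k).QuotHom ((PaB.ins hk i).obj (a, b)) ((PaB.ins hk i).obj (a', b')) :=
  Quotient.map₂ (fun f g => (PaB.ins hk i).map (X := (a, b)) (Y := (a', b')) (f, g))
    (fun _ _ h _ _ h' => K.sim_ins hk i h h') x y

/-- The map `ou` on the automorphisms in the quotient `PaB / ∼_N`. -/
def quotOu (K : NFI) {n : ℕ} {a : PaB n} (x : (K.sim n).QuotHom a a) : PB n ⧸ K.sub n :=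
  Quotient.map PaB.ouPure (fun _ _ h => QuotientGroup.leftRel_apply.mpr h) x

/-- The canonical projection from the completion `PaB^` to the quotient `PaB / ∼_N`. -/
def proj (K : NFI) {n : ℕ} {a b : PaB n} (x : HatHom a b) : (K.sim n).QuotHom a b :=
  x.val (K.sim n)

end NFI

/-- A morphism of truncated operads from `PaB^{≤4}` to `PaB^{≤4} / ∼_N` that is the identity on
objects. (In arities `> 4`, the sets of classes have one element, so `map` carries no
information there.) -/
structure TruncHom (K : NFI) where
  map : ∀ {n : ℕ} {a b : PaB n}, (a ⟶ b) → (K.sim n).QuotHom a b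
  map_id : ∀ {n : ℕ} (_ : n ≤ 4) (a : PaB n), map (𝟙 a) = ⟦𝟙 a⟧
  map_comp : ∀ {n : ℕ} (_ : n ≤ 4) {a b c : PaB n} (f : a ⟶ b) (g : b ⟶ c),
    map (f ≫ g) = (K.sim n).quotComp (map f) (map g)
  map_act : ∀ {n : ℕ} (_ : n ≤ 4) (θ : Equiv.Perm (Fin n)) {a b : PaB n} (f : a ⟶ b),
    map ((PaB.act θ).map f) = K.quotAct θ (map f)
  map_ins : ∀ {n m k : ℕ} (_ : k ≤ 4) (hk : n + m = k + 1) (i : Fin n) {a a' : PaB n}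
    {b b' : PaB m} (f : a ⟶ a') (g : b ⟶ b'),
    map ((PaB.ins hk i).map (X := (a, b)) (Y := (a', b')) (f, g)) = K.quotIns hk i (map f) (map g)

/-- The morphism `T_N : PaB^{≤4} → PaB^{≤4} / ∼_N` induced by an automorphism of `PaB^`. -/
def PaBHatAut.toTruncHom (T : PaBHatAut) (K : NFI) : TruncHom K where
  map f := K.proj (T.map (HatHom.incl f))
  map_id _ a := by rw [T.map_id]; rfl
  map_comp {n} _ a b c f g := by
    have : HatHom.incl (f ≫ g) = (HatHom.incl f).comp (HatHom.incl g) := rfl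
    rw [this, T.map_comp]; rfl
  map_act {n} _ θ a b f := by
    have : HatHom.incl ((PaB.act θ).map f) = (HatHom.incl f).map (PaB.act θ) := rfl
    rw [this, T.map_act]
    generalize T.map (HatHom.incl f) = x
    obtain ⟨g, hg⟩ := Quotient.exists_rep (x.val (K.sim n))
    have h := x.compat (K.sim n) ((K.sim n).comap (PaB.act θ))
      (fun _ _ _ _ h => K.sim_act θ h) g hg.symm
    simp only [NFI.proj, HatHom.map, NFI.quotAct]
    rw [h, ← hg]; rfl
  map_ins {n m k} _ hk i a a' b b' f g := by
    have : HatHom.incl ((PaB.ins hk i).map (X := (a, b)) (Y := (a', b')) (f, g)) =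
        HatHom.map₂ (PaB.ins hk i) (HatHom.incl f) (HatHom.incl g) := by
      have e : (PaB.ins hk i).map (X := (a, b)) (Y := (a', b')) (f, g) =
          (PaB.ins hk i).map (X := (a, b)) (Y := (a, b')) (𝟙 a, g) ≫
            (PaB.ins hk i).map (X := (a, b')) (Y := (a', b')) (f, 𝟙 b') := by
        rw [← Functor.map_comp, prod_comp, Category.id_comp, Category.comp_id]
      rw [e]; rfl
    rw [this, T.map_ins]
    generalize T.map (HatHom.incl f) = x
    generalize T.map (HatHom.incl g) = y
    obtain ⟨f', hf⟩ := Quotient.exists_rep (x.val (K.sim n))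
    obtain ⟨g', hg⟩ := Quotient.exists_rep (y.val (K.sim m))
    have h1 := x.compat (K.sim n) ((K.sim k).comap (Prod.sectL (PaB n) b' ⋙ PaB.ins hk i))
      (fun _ _ _ _ h => K.sim_ins hk i h (((K.sim m).rel b' b').iseqv.refl (𝟙 b'))) f' hf.symm
    have h2 := y.compat (K.sim m) ((K.sim k).comap (Prod.sectR a (PaB m) ⋙ PaB.ins hk i))
      (fun _ _ _ _ h => K.sim_ins hk i (((K.sim n).rel a a).iseqv.refl (𝟙 a)) h) g' hg.symm
    simp only [NFI.proj, HatHom.map₂, HatHom.comp, HatHom.map, NFI.quotIns]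
    rw [h1, h2, ← hf, ← hg]
    refine congrArg (Quot.mk _) ?_
    change (PaB.ins hk i).map (X := (a, b)) (Y := (a, b')) (𝟙 a, g') ≫
            (PaB.ins hk i).map (X := (a, b')) (Y := (a', b')) (f', 𝟙 b') = _
    rw [← Functor.map_comp, prod_comp, Category.id_comp, Category.comp_id]

namespace PaB

/-- The object `1(23)` of `PaB(3)`. -/
def obj1_23 : PaB 3 := ⟨.mul (.of ()) (.mul (.of ()) (.of ())), rfl, 1⟩

/-- The object `21` of `PaB(2)`. -/
def obj21 : PaB 2 := ⟨leftComb 1, rfl, Equiv.swap 0 1⟩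

/-- The associator `α : (12)3 → 1(23)`. -/
def alpha : std 2 ⟶ obj1_23 := ⟨1, by rw [map_one]; exact (inv_mul_cancel 1).symm⟩

/-- The braiding `β : 12 → 21`. -/
def beta : std 1 ⟶ obj21 := ⟨Braid.sig 2 0, by
  change Braid.rho 2 (Braid.sig 2 0) = (Equiv.swap 0 1)⁻¹ * 1
  rw [mul_one, Equiv.swap_inv]
  exact Braid.rho_of (n := 2) ⟨0, by decide⟩⟩

end PaB

theorem Braid.rho_sig_sq (n i : ℕ) : Braid.rho n (Braid.sig n i ^ 2) = 1 := by
  unfold Braid.sig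
  split_ifs with h
  · rw [map_pow, Braid.rho_of, sq]; exact Equiv.swap_mul_self _ _
  · simp

/-- The pure braid `σ_{i+1}²`, that is `x_{i+1,i+2}`. -/
def sqSig (n i : ℕ) : PB n := ⟨Braid.sig n i ^ 2, Braid.rho_sig_sq n i⟩

/-- The generator `x₁₂` of `PB₃`. -/
def x12 : PB 3 := sqSig 3 0
/-- The generator `x₂₃` of `PB₃`. -/
def x23 : PB 3 := sqSig 3 1
/-- The generator `x₁₃ = σ₂ σ₁² σ₂⁻¹` of `PB₃`. -/
def x13 : PB 3 := NFI.conj (Braid.sig 3 1) x12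

/-- The subgroup `F₂ = ⟨x₁₂, x₂₃⟩` of `PB₃`. -/
def F2 : Subgroup (PB 3) := Subgroup.closure {x12, x23}

namespace TruncHom

variable {K : NFI}

/-- `T` is the morphism `T_{m,f}`: it sends `α` to the class of `α · m(f)` and `β` to the class of
`β · m(x₁₂^m)`. (It is unique, because `PaB^{≤4}` is generated by `α` and `β`.) -/
def IsT (T : TruncHom K) (m : ℤ) (f : PB 3) : Prop :=
  T.map PaB.alpha = ⟦PaB.mm (n := 2) f ≫ PaB.alpha⟧ ∧
  T.map PaB.beta = ⟦PaB.mm (n := 1) (sqSig 2 0 ^ m) ≫ PaB.beta⟧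

/-- The map `T^{PB_{n+1}} = ou ∘ T ∘ m : PB_{n+1} → PB_{n+1} / N_{PB_{n+1}}`. -/
def onPB (T : TruncHom K) (n : ℕ) (h : PB (n + 1)) : PB (n + 1) ⧸ K.sub (n + 1) :=
  K.quotOu (T.map (PaB.mm h))

end TruncHom

namespace NFI

/-- The pair `(m, f)` represents a GT-pair: it satisfies the two hexagon relations in
`B₃ / N_{PB₃}` and the pentagon relation in `PB₄ / N`. -/
def IsGTPair (K : NFI) (m : ℤ) (f : PB 3) : Prop :=
  ((Braid.sig 3 0 * ↑(x12 ^ m) * ↑f⁻¹ * Braid.sig 3 1 * ↑(x23 ^ m) * ↑f : Braid 3) :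
      Braid 3 ⧸ K.subB 3) =
    (↑f⁻¹ * Braid.sig 3 0 * Braid.sig 3 1 * ↑((x13 * x23) ^ m) : Braid 3) ∧
  ((↑f⁻¹ * Braid.sig 3 1 * ↑(x23 ^ m) * ↑f * Braid.sig 3 0 * ↑(x12 ^ m) : Braid 3) :
      Braid 3 ⧸ K.subB 3) =
    (Braid.sig 3 1 * Braid.sig 3 0 * ↑((x12 * x13) ^ m) * ↑f : Braid 3) ∧
  ((PaB.cofaceOuter 2 1 f * PaB.cofaceInner 2 1 f * PaB.cofaceOuter 2 0 f : PB 4) :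
      PB 4 ⧸ K.sub 4) =
    (PaB.cofaceInner 2 2 f * PaB.cofaceInner 2 0 f : PB 4)

/-- The pair `(m, f)` represents a GT-shadow: a GT-pair for which the homomorphisms
`T_{m,f}^{PB_n} : PB_n → PB_n / N_{PB_n}`, `n = 4, 3, 2`, are onto. -/
def IsGTShadow (K : NFI) (m : ℤ) (f : PB 3) : Prop :=
  K.IsGTPair m f ∧ ∃ T : TruncHom K, T.IsT m f ∧
    Function.Surjective (T.onPB 3) ∧ Function.Surjective (T.onPB 2) ∧ Function.Surjective (T.onPB 1)

/-- The GT-shadow `[(m, f)]` is genuine: it comes from a continuous automorphism of `PaB^`. -/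
def IsGenuine (K : NFI) (m : ℤ) (f : PB 3) : Prop :=
  K.IsGTShadow m f ∧ ∃ T : PaBHatAut, (T.toTruncHom K).IsT m f

/-- The subgroup `N_{F₂} = N_{PB₃} ∩ F₂` of `F₂`. -/
abbrev subF2 (K : NFI) : Subgroup F2 := (K.sub 3).subgroupOf F2

/-- The natural embedding `F₂ / N_{F₂} → PB₃ / N_{PB₃}`. -/
def quotF2 (K : NFI) : F2 ⧸ K.subF2 →* PB 3 ⧸ K.sub 3 :=
  QuotientGroup.map K.subF2 (K.sub 3) F2.subtype le_rfl

/-- The GT-shadow `[(m, f)]` is charming: the coset of `f` is represented by an element of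
`[F₂, F₂]`, and `T_{m,f}^{PB₃}` restricts to a homomorphism `F₂ → F₂ / N_{F₂}` that is onto. -/
def IsCharming (K : NFI) (m : ℤ) (f : PB 3) : Prop :=
  K.IsGTShadow m f ∧
  (∃ f₁ ∈ ⁅F2, F2⁆, (f₁ : PB 3 ⧸ K.sub 3) = f) ∧
  ∃ T : TruncHom K, T.IsT m f ∧ ∃ t : F2 →* F2 ⧸ K.subF2,
    (∀ w : F2, K.quotF2 (t w) = T.onPB 2 (w : PB 3)) ∧ Function.Surjective t

end NFI

/-! The argument rests on `PB₃` being the product of `F₂` and the central subgroup generated by the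
full twist `c` (`exists_F2_mul_fullTwist`), and on the detection of the classes of `x₁₂`, `x₂₃`, `c`
in the abelianization by the three pairwise linking numbers (`linking_generators`). The linking
number of strands 1 and 3 vanishes on `x₁₂` and `x₂₃` and is 1 on `c`.

Since the shadow is genuine, it lifts to every smaller subgroup. Let `d` be the index of `N_{PB₃}`,
so that `d`-th powers of pure braids lie in `N_{PB₃}`. Let `N'` be the part of `N` on which all
linking numbers vanish modulo `d` (`NFI.refine`). The automorphism induces a morphism `T'` modulo
`N'`, with an associated `f'` that agrees with `f` modulo `N_{PB₃}`. Working with `N'` matters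
because linking numbers modulo `d` need not be defined on quotients by the subgroups attached to
`N`.

Commutator part: the two paths around the pentagon have the same image under `T'`
(`TruncHom.pentagon`). Counting linking numbers of suitable pairs among the four strands gives `2ℓ =
ℓ` for each linking number `ℓ` of `f'` modulo `d` (`linking_eq_one_of_pentagon`). Hence `f'` is a
product of an element of `[F₂, F₂]` and powers of `x₁₂`, `x₂₃`, `c` with exponents divisible by `d`,
and these powers disappear modulo `N_{PB₃}`.

Homomorphism part: operad compatibility forces `x₁₂ ↦ x₁₂^l`, `x₂₃ ↦ f⁻¹ x₂₃^l f` and `c ↦ c^l` for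
a common `l` (`TruncHom.exists_onPB_generators`). Once `f` is replaced by a representative in `F₂`,
the image of `F₂` lies in `F₂/N_{F₂}`.

Surjectivity part: density of `PaB` in its completion makes `T'` onto on `PB₃`
(`PaBHatAut.onPB_surjective`). If `u c^k`, with `u` in `F₂`, is sent by `T'` to the class of `w` in
`F₂`, comparing the linking numbers of strands 1 and 3 shows that `d` divides the exponent of `c` in
the image of `c^k`. Modulo `N_{PB₃}` that power vanishes, and `u` alone is sent to `w`. -/

/-! ### Generators of PB₂ and the structure of PB₃ -/

/-- Every pure braid on two strands is a power of `σ₁²`. -/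
theorem PB_two_eq_zpow (h : PB 2) : ∃ l : ℤ, h = sqSig 2 0 ^ l := by
  have hpow : ∀ g : Braid 2, ∃ k : ℤ, g = Braid.sig 2 0 ^ k := by
    intro g
    induction g using Braid.induction with
    | h1 => exact ⟨0, (zpow_zero _).symm⟩
    | hg i =>
      refine ⟨1, ?_⟩
      rw [zpow_one, ← Braid.sig_of, show (i : ℕ) = 0 by omega]
    | hm x y hx hy =>
      obtain ⟨a, rfl⟩ := hx
      obtain ⟨b, rfl⟩ := hy
      exact ⟨a + b, (zpow_add _ _ _).symm⟩
    | hi x hx =>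
      obtain ⟨a, rfl⟩ := hx
      exact ⟨-a, (zpow_neg _ _).symm⟩
  obtain ⟨k, hk⟩ := hpow h
  have hr : Braid.rho 2 h = 1 := h.2
  rcases Int.even_or_odd' k with ⟨l, rfl | rfl⟩
  · refine ⟨l, Subtype.ext ?_⟩
    rw [hk, zpow_mul]
    rfl
  · exfalso
    rw [hk, zpow_add, zpow_mul, map_mul, map_zpow] at hr
    have h2 : Braid.rho 2 (Braid.sig 2 0 ^ (2 : ℤ)) = 1 := Braid.rho_sig_sq 2 0
    rw [h2, one_zpow, one_mul, zpow_one] at hr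
    -- An odd power of `σ₁` acts as the transposition, which moves the first position.
    have := Braid.rho_sig_val (n := 2) (j := 0) (by decide) 0
    rw [hr] at this
    simp at this

theorem cofaceOuter_zero_sqSig : PaB.cofaceOuter 1 0 (sqSig 2 0) = x12 := by
  apply Subtype.ext
  rw [NFI.cofaceOuter_coe]
  change Braid.shift 2 3 0 _ (Braid.sig 2 0 ^ 2) = Braid.sig 3 0 ^ 2
  rw [map_pow, show Braid.sig 2 0 = PresentedGroup.of ⟨0, by decide⟩ from
    Braid.sig_of (n := 2) ⟨0, by decide⟩, Braid.shift_of]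
  rfl

theorem cofaceOuter_one_sqSig : PaB.cofaceOuter 1 1 (sqSig 2 0) = x23 := by
  apply Subtype.ext
  rw [NFI.cofaceOuter_coe]
  change Braid.shift 2 3 1 _ (Braid.sig 2 0 ^ 2) = Braid.sig 3 1 ^ 2
  rw [map_pow, show Braid.sig 2 0 = PresentedGroup.of ⟨0, by decide⟩ from
    Braid.sig_of (n := 2) ⟨0, by decide⟩, Braid.shift_of]
  rfl

/-- The full twist of the first two strands, run as a ribbon, around the third one. -/
def ribbonTwist : PB 3 := PaB.cofaceInner 1 0 (sqSig 2 0)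

theorem coe_ribbonTwist : (ribbonTwist : Braid 3) =
    Braid.sig 3 1 * Braid.sig 3 0 * (Braid.sig 3 0 * Braid.sig 3 1) := by
  rw [ribbonTwist, NFI.cofaceInner_coe]
  change Braid.cable _ (Braid.sig 2 0 ^ 2) 0 = _
  rw [sq, Braid.cable_mul, show Braid.sig 2 0 = PresentedGroup.of ⟨0, by decide⟩ from
    Braid.sig_of (n := 2) ⟨0, by decide⟩, Braid.cable_of, Braid.cable_of, Braid.rho_of,
    Braid.adjSwap_val, Braid.adjSwap_val]
  simp [Braid.cableGen, Braid.strandOver, Braid.blockOver]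

/-- The full twist on three strands. -/
def fullTwist : PB 3 := x12 * ribbonTwist

theorem coe_fullTwist : (fullTwist : Braid 3) =
    Braid.sig 3 0 ^ 2 * (Braid.sig 3 1 * Braid.sig 3 0 * (Braid.sig 3 0 * Braid.sig 3 1)) := by
  rw [← coe_ribbonTwist]
  rfl

/-- The full twist is the square of the half twist `aba`; in this form it is symmetric in `a` and
`b`. -/
theorem twist_eq_sq_of_braid {G : Type*} [Group G] {a b : G} (h : a * b * a = b * a * b) :
    a ^ 2 * (b * a * (a * b)) = (a * b * a) * (a * b * a) := by
  calc a ^ 2 * (b * a * (a * b)) = a * (a * b * a) * (a * b) := by rw [sq]; group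
    _ = a * (b * a * b) * (a * b) := by rw [h]
    _ = (a * b * a) * (b * a * b) := by group
    _ = _ := by rw [← h]

/-- Conjugation by the half twist `aba` exchanges `a` and `b`, so its square commutes with both. -/
theorem twist_comm_of_braid {G : Type*} [Group G] {a b : G} (h : a * b * a = b * a * b) :
    Commute (a ^ 2 * (b * a * (a * b))) a ∧ Commute (a ^ 2 * (b * a * (a * b))) b := by
  have ha : (a * b * a) * a = b * (a * b * a) := by
    calc (a * b * a) * a = b * a * b * a := by rw [h]
      _ = _ := by group
  have hb : (a * b * a) * b = a * (a * b * a) := by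
    calc (a * b * a) * b = a * (b * a * b) := by group
      _ = _ := by rw [← h]
  rw [twist_eq_sq_of_braid h]
  constructor
  · change _ * _ = _ * _
    rw [mul_assoc, ha, ← mul_assoc, hb, mul_assoc]
  · change _ * _ = _ * _
    rw [mul_assoc, hb, ← mul_assoc, ha, mul_assoc]

theorem sig_three_braid : Braid.sig 3 0 * Braid.sig 3 1 * Braid.sig 3 0 =
    Braid.sig 3 1 * Braid.sig 3 0 * Braid.sig 3 1 := Braid.sig_braid 3 (by decide)

theorem braid_three_induction {C : Braid 3 → Prop} (g : Braid 3) (h1 : C 1)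
    (h0 : C (Braid.sig 3 0)) (h2 : C (Braid.sig 3 1))
    (hm : ∀ x y, C x → C y → C (x * y)) (hi : ∀ x, C x → C x⁻¹) : C g := by
  induction g using Braid.induction with
  | h1 => exact h1
  | hg i =>
    rw [← Braid.sig_of]
    obtain hi | hi : (i : ℕ) = 0 ∨ (i : ℕ) = 1 := by omega
    · rw [hi]; exact h0
    · rw [hi]; exact h2
  | hm x y hx hy => exact hm x y hx hy
  | hi x hx => exact hi x hx

theorem fullTwist_comm_braid (g : Braid 3) : Commute (fullTwist : Braid 3) g := by
  have h := twist_comm_of_braid sig_three_braid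
  rw [← coe_fullTwist] at h
  induction g using braid_three_induction with
  | h1 => exact Commute.one_right _
  | h0 => exact h.1
  | h2 => exact h.2
  | hm x y hx hy => exact hx.mul_right hy
  | hi x hx => exact hx.inv_right

theorem fullTwist_comm (h : PB 3) : Commute fullTwist h :=
  Subtype.ext (fullTwist_comm_braid h)

/-- A group generated by two involutions that satisfy the braid relation has at most six
elements. -/
theorem word_of_braid_involutions {G : Type*} [Group G] {s t : G} (hs : s * s = 1) (ht : t * t = 1)
    (h : s * t * s = t * s * t) (g : G) (hg : g ∈ Subgroup.closure {s, t}) :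
    g = 1 ∨ g = s ∨ g = t ∨ g = s * t ∨ g = t * s ∨ g = s * t * s := by
  have hs' : ∀ x, x * s * s = x := fun x => by rw [mul_assoc, hs, mul_one]
  have ht' : ∀ x, x * t * t = x := fun x => by rw [mul_assoc, ht, mul_one]
  have es : s⁻¹ = s := inv_eq_of_mul_eq_one_left hs
  have et : t⁻¹ = t := inv_eq_of_mul_eq_one_left ht
  have mul_s : ∀ x, (x = 1 ∨ x = s ∨ x = t ∨ x = s * t ∨ x = t * s ∨ x = s * t * s) →
      (x * s = 1 ∨ x * s = s ∨ x * s = t ∨ x * s = s * t ∨ x * s = t * s ∨ x * s = s * t * s) := by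
    rintro x (rfl | rfl | rfl | rfl | rfl | rfl)
    · simp
    · simp [hs]
    · simp
    · simp
    · simp [hs']
    · simp [hs']
  have mul_t : ∀ x, (x = 1 ∨ x = s ∨ x = t ∨ x = s * t ∨ x = t * s ∨ x = s * t * s) →
      (x * t = 1 ∨ x * t = s ∨ x * t = t ∨ x * t = s * t ∨ x * t = t * s ∨ x * t = s * t * s) := by
    rintro x (rfl | rfl | rfl | rfl | rfl | rfl)
    · simp
    · simp
    · simp [ht]
    · simp [ht']
    · simp [h]
    · simp [h, ht']
  induction hg using Subgroup.closure_induction_right with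
  | one => simp
  | mul_right x _ y hy ih =>
    rcases hy with rfl | rfl
    · exact mul_s x ih
    · exact mul_t x ih
  | mul_inv_cancel x _ y hy ih =>
    rcases hy with rfl | rfl
    · rw [es]; exact mul_s x ih
    · rw [et]; exact mul_t x ih

/-- The subgroup of `B₃` generated by `σ₁²`, `σ₂²` and the full twist. -/
def twistSubgroup : Subgroup (Braid 3) :=
  Subgroup.closure {(x12 : Braid 3), (x23 : Braid 3), (fullTwist : Braid 3)}

theorem twistSubgroup_le : twistSubgroup ≤ PB 3 := by
  rw [twistSubgroup, Subgroup.closure_le]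
  rintro _ (rfl | rfl | rfl)
  · exact x12.2
  · exact x23.2
  · exact fullTwist.2

/-- Both conjugates are words in `a²`, `b²` and the full twist. Stating this for abstract `a`, `b`
lets it be applied to `(σ₁, σ₂)` and to `(σ₂, σ₁)`. -/
theorem conj_mem_twistSubgroup {a b : Braid 3} (ha : a ^ 2 ∈ twistSubgroup) (hb : b ^ 2 ∈ twistSubgroup)
    (hc : a ^ 2 * (b * a * (a * b)) ∈ twistSubgroup) :
    b * a ^ 2 * b⁻¹ ∈ twistSubgroup ∧ b⁻¹ * a ^ 2 * b ∈ twistSubgroup := by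
  have e : b * a ^ 2 * b⁻¹ = (a ^ 2)⁻¹ * (a ^ 2 * (b * a * (a * b))) * (b ^ 2)⁻¹ := by
    rw [sq, sq]; group
  have e' : b⁻¹ * a ^ 2 * b = (b ^ 2)⁻¹ * (b * a ^ 2 * b⁻¹) * b ^ 2 := by
    rw [sq b]; group
  have h1 : b * a ^ 2 * b⁻¹ ∈ twistSubgroup := by
    rw [e]; exact mul_mem (mul_mem (inv_mem ha) hc) (inv_mem hb)
  exact ⟨h1, by rw [e']; exact mul_mem (mul_mem (inv_mem hb) h1) hb⟩

instance twistSubgroup_normal : twistSubgroup.Normal := by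
  set a := Braid.sig 3 0 with ha
  set b := Braid.sig 3 1 with hb
  have hab : a * b * a = b * a * b := sig_three_braid
  have h1 : a ^ 2 ∈ twistSubgroup := Subgroup.subset_closure (Or.inl rfl)
  have h2 : b ^ 2 ∈ twistSubgroup := Subgroup.subset_closure (Or.inr (Or.inl rfl))
  have h3 : (fullTwist : Braid 3) ∈ twistSubgroup := Subgroup.subset_closure (Or.inr (Or.inr rfl))
  have hc := coe_fullTwist
  have hc' : b ^ 2 * (a * b * (b * a)) = fullTwist := by
    rw [hc, twist_eq_sq_of_braid hab.symm, ← hab, ← twist_eq_sq_of_braid hab]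
  have kb := conj_mem_twistSubgroup h1 h2 (hc ▸ h3)
  have ka := conj_mem_twistSubgroup h2 h1 (hc' ▸ h3)
  -- Conjugation by `g` and by `g⁻¹` are treated together, so that the inverse step of the induction
  -- only swaps the two halves.
  have key : ∀ g : Braid 3, (∀ x ∈ twistSubgroup, g * x * g⁻¹ ∈ twistSubgroup) ∧
      ∀ x ∈ twistSubgroup, g⁻¹ * x * g ∈ twistSubgroup := by
    have gen : ∀ g : Braid 3, g * a ^ 2 * g⁻¹ ∈ twistSubgroup → g * b ^ 2 * g⁻¹ ∈ twistSubgroup →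
        ∀ x ∈ twistSubgroup, g * x * g⁻¹ ∈ twistSubgroup := by
      intro g hga hgb x hx
      have : twistSubgroup ≤ twistSubgroup.comap (MulAut.conj g).toMonoidHom := by
        nth_rewrite 1 [twistSubgroup]
        rw [Subgroup.closure_le]
        rintro _ (rfl | rfl | rfl)
        · exact hga
        · exact hgb
        · change g * fullTwist * g⁻¹ ∈ twistSubgroup
          rwa [← (fullTwist_comm_braid g).eq, mul_inv_cancel_right]
      exact this hx
    intro g
    induction g using braid_three_induction with
    | h1 => simp
    | h0 =>
      refine ⟨gen _ ?_ ka.1, ?_⟩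
      · rwa [← ha, sq, mul_assoc, mul_assoc, mul_inv_cancel, mul_one, ← sq]
      · simpa using gen a⁻¹ (by rw [sq]; simpa [sq] using h1) (by simpa using ka.2)
    | h2 =>
      refine ⟨gen _ kb.1 ?_, ?_⟩
      · rwa [← hb, sq, mul_assoc, mul_assoc, mul_inv_cancel, mul_one, ← sq]
      · simpa using gen b⁻¹ (by simpa using kb.2) (by rw [sq]; simpa [sq] using h2)
    | hm x y hx hy =>
      refine ⟨fun z hz => ?_, fun z hz => ?_⟩
      · have := hx.1 _ (hy.1 z hz)
        simpa [mul_assoc] using this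
      · have := hy.2 _ (hx.2 z hz)
        simpa [mul_assoc] using this
    | hi x hx => exact ⟨by simpa using hx.2, by simpa using hx.1⟩
  exact ⟨fun x hx g => (key g).1 x hx⟩

/-- In the quotient of `B₃` by this normal subgroup, `σ₁` and `σ₂` become involutions satisfying the
braid relation, so every class is one of six words. The permutation `ρ` separates the empty word
from the other five, hence a pure braid has trivial class. -/
theorem twistSubgroup_eq : twistSubgroup = PB 3 := by
  refine le_antisymm twistSubgroup_le fun g hg => ?_
  let s : Braid 3 ⧸ twistSubgroup := (Braid.sig 3 0 : Braid 3)
  let t : Braid 3 ⧸ twistSubgroup := (Braid.sig 3 1 : Braid 3)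
  have hs : s * s = 1 := (QuotientGroup.eq_one_iff _).mpr
    (Subgroup.subset_closure (Or.inl (sq _).symm))
  have ht : t * t = 1 := (QuotientGroup.eq_one_iff _).mpr
    (Subgroup.subset_closure (Or.inr (Or.inl (sq _).symm)))
  have hb : s * t * s = t * s * t :=
    congrArg (QuotientGroup.mk (s := twistSubgroup)) sig_three_braid
  have hcl : (g : Braid 3 ⧸ twistSubgroup) ∈ Subgroup.closure {s, t} := by
    -- The claim holds for all braids; purity would not be inherited by the generators in the
    -- induction.
    clear hg
    induction g using braid_three_induction with
    | h1 => exact one_mem _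
    | h0 => exact Subgroup.subset_closure (Or.inl rfl)
    | h2 => exact Subgroup.subset_closure (Or.inr rfl)
    | hm x y hx hy => exact mul_mem hx hy
    | hi x hx => exact inv_mem hx
  -- The subgroup consists of pure braids, so any word congruent to `g` must itself be pure.
  have hrho : ∀ u : Braid 3, (g : Braid 3 ⧸ twistSubgroup) = u → Braid.rho 3 u = 1 := by
    intro u hu
    have h1 : Braid.rho 3 (g⁻¹ * u) = 1 := twistSubgroup_le (QuotientGroup.eq.mp hu)
    rwa [map_mul, map_inv, show Braid.rho 3 g = 1 from hg, inv_one, one_mul] at h1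
  have e0 : Braid.rho 3 (Braid.sig 3 0) = Equiv.swap 0 1 := Braid.rho_of (n := 3) ⟨0, by decide⟩
  have e1 : Braid.rho 3 (Braid.sig 3 1) = Equiv.swap 1 2 := Braid.rho_of (n := 3) ⟨1, by decide⟩
  rcases word_of_braid_involutions hs ht hb _ hcl with h | h | h | h | h | h
  · exact (QuotientGroup.eq_one_iff _).mp h
  · have := hrho _ h
    rw [e0] at this
    exact absurd this (by decide)
  · have := hrho _ h
    rw [e1] at this
    exact absurd this (by decide)
  · have := hrho (_ * _) h
    rw [map_mul, e0, e1] at this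
    exact absurd this (by decide)
  · have := hrho (_ * _) h
    rw [map_mul, e0, e1] at this
    exact absurd this (by decide)
  · have := hrho (_ * _ * _) h
    rw [map_mul, map_mul, e0, e1] at this
    exact absurd this (by decide)

theorem closure_PB_three : Subgroup.closure {x12, x23, fullTwist} = ⊤ := by
  apply Subgroup.map_injective (PB 3).subtype_injective
  rw [MonoidHom.map_closure, Set.image_insert_eq, Set.image_pair, ← MonoidHom.range_eq_map,
    Subgroup.range_subtype]
  exact twistSubgroup_eq

/-- `PB₃` is the product of `F₂` and the group generated by the full twist. -/
theorem exists_F2_mul_fullTwist (h : PB 3) : ∃ u ∈ F2, ∃ k : ℤ, h = u * fullTwist ^ k := by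
  have hh : h ∈ Subgroup.closure {x12, x23, fullTwist} := by rw [closure_PB_three]; trivial
  induction hh using Subgroup.closure_induction with
  | mem x hx =>
    rcases hx with rfl | rfl | rfl
    · exact ⟨_, Subgroup.subset_closure (Or.inl rfl), 0, by simp⟩
    · exact ⟨_, Subgroup.subset_closure (Or.inr rfl), 0, by simp⟩
    · exact ⟨1, one_mem _, 1, by simp⟩
  | one => exact ⟨1, one_mem _, 0, by simp⟩
  | mul x y _ _ hx hy =>
    obtain ⟨u, hu, k, rfl⟩ := hx
    obtain ⟨v, hv, j, rfl⟩ := hy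
    refine ⟨u * v, mul_mem hu hv, k + j, ?_⟩
    rw [zpow_add, mul_assoc, ← mul_assoc _ v, ((fullTwist_comm v).zpow_left k).eq]
    simp only [mul_assoc]
  | inv x _ hx =>
    obtain ⟨u, hu, k, rfl⟩ := hx
    refine ⟨u⁻¹, inv_mem hu, -k, ?_⟩
    rw [mul_inv_rev, zpow_neg]
    exact (((fullTwist_comm u).zpow_left k).inv_inv).eq

/-- The abelianization of `F₂` is generated by the classes of `x₁₂` and `x₂₃`; freeness of `F₂`
plays no role. -/
theorem exists_commutator_of_mem_F2 {u : PB 3} (hu : u ∈ F2) :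
    ∃ a b : ℤ, ∃ z ∈ ⁅F2, F2⁆, u = x12 ^ a * x23 ^ b * z := by
  let q : F2 →* Abelianization F2 := Abelianization.of
  let y12 : F2 := ⟨x12, Subgroup.subset_closure (Or.inl rfl)⟩
  let y23 : F2 := ⟨x23, Subgroup.subset_closure (Or.inr rfl)⟩
  have key : ∀ v (hv : v ∈ F2), ∃ a b : ℤ, q ⟨v, hv⟩ = q (y12 ^ a * y23 ^ b) := by
    intro v hv
    induction hv using Subgroup.closure_induction with
    | mem x hx =>
      rcases hx with rfl | rfl
      · exact ⟨1, 0, by simp [y12]⟩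
      · exact ⟨0, 1, by simp [y23]⟩
    | one => exact ⟨0, 0, by simp; exact map_one q⟩
    | mul x y hx hy ihx ihy =>
      obtain ⟨a, b, h⟩ := ihx
      obtain ⟨a', b', h'⟩ := ihy
      refine ⟨a + a', b + b', ?_⟩
      have : q ⟨x * y, mul_mem hx hy⟩ = q ⟨x, hx⟩ * q ⟨y, hy⟩ := map_mul q ⟨x, hx⟩ ⟨y, hy⟩
      rw [this, h, h']
      simp only [map_mul, map_zpow, zpow_add]
      exact mul_mul_mul_comm _ _ _ _
    | inv x hx ih =>
      obtain ⟨a, b, h⟩ := ih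
      refine ⟨-a, -b, ?_⟩
      have : q ⟨x⁻¹, inv_mem hx⟩ = (q ⟨x, hx⟩)⁻¹ := map_inv q ⟨x, hx⟩
      rw [this, h]
      simp only [map_mul, map_zpow, zpow_neg, mul_inv, map_inv]
  obtain ⟨a, b, h⟩ := key u hu
  refine ⟨a, b, (x12 ^ a * x23 ^ b)⁻¹ * u, ?_, by group⟩
  have h1 : (y12 ^ a * y23 ^ b)⁻¹ * ⟨u, hu⟩ ∈ commutator F2 := by
    rw [← Abelianization.ker_of, MonoidHom.mem_ker, map_mul, map_inv, inv_mul_eq_one]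
    exact h.symm
  have h2 := Subgroup.mem_map_of_mem F2.subtype h1
  rwa [map_commutator_eq, Subgroup.range_subtype] at h2

/-! ### Truncated morphisms in terms of braids -/

namespace NFI

variable {K : NFI}

instance subB_normal (K : NFI) (n : ℕ) : (K.subB n).Normal where
  conj_mem x hx g := by
    obtain ⟨h, hx⟩ := mem_subB.mp hx
    exact ⟨conj g ⟨x, h⟩, K.conj_mem g ⟨x, h⟩ hx, rfl⟩

theorem coe_mem_subB {n : ℕ} {h : PB n} : (h : Braid n) ∈ K.subB n ↔ h ∈ K.sub n := by
  rw [mem_subB]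
  exact ⟨fun ⟨_, h⟩ => h, fun h' => ⟨h.2, h'⟩⟩

theorem mk_coe_eq_iff {n : ℕ} {h h' : PB n} :
    (((h : Braid n) : Braid n ⧸ K.subB n) = (h' : Braid n)) ↔ (h : PB n ⧸ K.sub n) = h' := by
  rw [QuotientGroup.eq, QuotientGroup.eq, ← coe_mem_subB]
  rfl

/-- The class, modulo `N_{PB_n}`, of the braid of a morphism of the quotient `PaB / ∼_N`. -/
def quotBraid (K : NFI) {n : ℕ} {a b : PaB n} (x : (K.sim n).QuotHom a b) :
    Braid n ⧸ K.subB n :=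
  Quotient.lift (fun f : a ⟶ b => (f.ou : Braid n ⧸ K.subB n))
    (fun _ _ h => QuotientGroup.eq.mpr (sim_iff.mp h)) x

theorem quotBraid_mk {n : ℕ} {a b : PaB n} (f : a ⟶ b) :
    K.quotBraid (⟦f⟧ : (K.sim n).QuotHom a b) = f.ou := rfl

theorem quotBraid_comp {n : ℕ} {a b c : PaB n} (x : (K.sim n).QuotHom a b)
    (y : (K.sim n).QuotHom b c) :
    K.quotBraid ((K.sim n).quotComp x y) = K.quotBraid y * K.quotBraid x := by
  obtain ⟨f, rfl⟩ := Quotient.exists_rep x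
  obtain ⟨g, rfl⟩ := Quotient.exists_rep y
  rfl

/-- Equations in `PB_n/N_{PB_n}` may be checked in `B_n/N_{PB_n}`, where morphisms between different
objects also have classes. -/
theorem quotOu_eq_iff {n : ℕ} {a : PaB n} (x : (K.sim n).QuotHom a a) (h : PB n) :
    K.quotOu x = h ↔ K.quotBraid x = (h : Braid n) := by
  obtain ⟨f, rfl⟩ := Quotient.exists_rep x
  exact (mk_coe_eq_iff (h := PaB.ouPure f)).symm

end NFI

namespace TruncHom

variable {K : NFI} (T : TruncHom K)

/-- The class, modulo `N_{PB_n}`, of the braid of the image of a morphism under `T`. -/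
def onBraid {n : ℕ} {a b : PaB n} (f : a ⟶ b) : Braid n ⧸ K.subB n := K.quotBraid (T.map f)

theorem onBraid_comp {n : ℕ} (hn : n ≤ 4) {a b c : PaB n} (f : a ⟶ b) (g : b ⟶ c) :
    T.onBraid (f ≫ g) = T.onBraid g * T.onBraid f := by
  rw [onBraid, T.map_comp hn, NFI.quotBraid_comp]
  rfl

/-- Inserted objects agree with the named ones only up to a provable equality of permutations;
passing to braids removes the dependence on source and target. -/
theorem onBraid_congr {n : ℕ} {a b a' b' : PaB n} (f : a ⟶ b) (f' : a' ⟶ b') (ha : a = a')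
    (hb : b = b') (h : f.ou = f'.ou) : T.onBraid f = T.onBraid f' := by
  subst ha hb
  rw [PaBHom.ext h]

theorem onBraid_ins {n m k : ℕ} (hn : k ≤ 4) (hk : n + m = k + 1) (i : Fin n) {a a' : PaB n}
    {b b' : PaB m} {f f' : a ⟶ a'} {g g' : b ⟶ b'} (hf : T.map f = ⟦f'⟧) (hg : T.map g = ⟦g'⟧) :
    T.onBraid ((PaB.ins hk i).map (X := (a, b)) (Y := (a', b')) (f, g)) =
      (Braid.insert hk f'.ou g'.ou (a.perm⁻¹ i) : Braid k) := by
  rw [onBraid, T.map_ins hn, hf, hg]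
  rfl

theorem onPB_eq_iff {n : ℕ} {h h' : PB (n + 1)} :
    T.onPB n h = h' ↔ T.onBraid (PaB.mm h) = (h' : Braid (n + 1)) := NFI.quotOu_eq_iff _ _

/-- `T^{PB_{n+1}}` as a homomorphism. -/
def pbHom (n : ℕ) (hn : n ≤ 3) : PB (n + 1) →* PB (n + 1) ⧸ K.sub (n + 1) :=
  MonoidHom.mk' (T.onPB n) (by
    intro h h'
    obtain ⟨u, hu⟩ := QuotientGroup.mk_surjective (T.onPB n h)
    obtain ⟨u', hu'⟩ := QuotientGroup.mk_surjective (T.onPB n h')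
    rw [← hu, ← hu', ← QuotientGroup.mk_mul, onPB_eq_iff, PaB.mm_mul, onBraid_comp _ (by omega),
      T.onPB_eq_iff.mp hu.symm, T.onPB_eq_iff.mp hu'.symm]
    rfl)

theorem insObj_std_one_std_one_zero :
    PaB.insObj (show 2 + 2 = 3 + 1 from rfl) 0 (PaB.std 1) (PaB.std 1) = PaB.std 2 :=
  PaB.ext rfl (insPerm_one _ _)

theorem insObj_std_one_std_one_one :
    PaB.insObj (show 2 + 2 = 3 + 1 from rfl) 1 (PaB.std 1) (PaB.std 1) = PaB.obj1_23 :=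
  PaB.ext rfl (insPerm_one _ _)

/-- `PB₂` is generated by `σ₁²`; the resulting exponent `l` governs all the generators in arity 3.
-/
theorem exists_map_sqSig : ∃ l : ℤ,
    T.map (PaB.mm (n := 1) (sqSig 2 0)) = ⟦PaB.mm (n := 1) (sqSig 2 0 ^ l)⟧ := by
  obtain ⟨g, hg⟩ := Quotient.exists_rep (T.map (PaB.mm (n := 1) (sqSig 2 0)))
  obtain ⟨l, hl⟩ := PB_two_eq_zpow (PaB.ouPure g)
  refine ⟨l, hg.symm.trans (congrArg _ (PaBHom.ext ?_))⟩
  exact congrArg Subtype.val hl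

/-- The values of `T^{PB₃}` on the generators of `PB₃`. -/
theorem exists_onPB_generators {f : PB 3} (hf : T.map PaB.alpha = ⟦PaB.mm (n := 2) f ≫ PaB.alpha⟧) :
    ∃ l : ℤ, T.onPB 2 x12 = ((x12 ^ l : PB 3) : PB 3 ⧸ K.sub 3) ∧
      T.onPB 2 x23 = ((f⁻¹ * x23 ^ l * f : PB 3) : PB 3 ⧸ K.sub 3) ∧
      T.onPB 2 fullTwist = ((fullTwist ^ l : PB 3) : PB 3 ⧸ K.sub 3) := by
  obtain ⟨l, hl⟩ := T.exists_map_sqSig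
  have hid : T.map (𝟙 (PaB.std 1)) = ⟦𝟙 (PaB.std 1)⟧ := T.map_id (by norm_num) _
  have h12 : T.onPB 2 x12 = ((x12 ^ l : PB 3) : PB 3 ⧸ K.sub 3) := by
    rw [onPB_eq_iff, ← cofaceOuter_zero_sqSig, ← map_zpow]
    refine Eq.trans (T.onBraid_congr _ _ insObj_std_one_std_one_zero.symm
      insObj_std_one_std_one_zero.symm ?_)
      (T.onBraid_ins (by norm_num) (show 2 + 2 = 3 + 1 from rfl) 0 hid hl)
    rfl
  -- Here `σ₁²` is the outer braid and the identity is inserted, whereas `x₁₂` inserts `σ₁²` into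
  -- the identity; both receive the same exponent `l`.
  have hrib : T.onPB 2 ribbonTwist = ((ribbonTwist ^ l : PB 3) : PB 3 ⧸ K.sub 3) := by
    rw [onPB_eq_iff, ribbonTwist, ← map_zpow]
    refine Eq.trans (T.onBraid_congr _ _ insObj_std_one_std_one_zero.symm
      insObj_std_one_std_one_zero.symm ?_)
      (T.onBraid_ins (by norm_num) (show 2 + 2 = 3 + 1 from rfl) 0 hl hid)
    rfl
  refine ⟨l, h12, ?_, ?_⟩
  -- On `1(23)` the braid `x₂₃` is the insertion of `σ₁²` at the second slot; conjugation by `α`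
  -- transports it to `(12)3` and brings in `f`.
  · let g : PaB.obj1_23 ⟶ PaB.obj1_23 := ⟨x23, by rw [inv_mul_cancel]; exact x23.2⟩
    have hg : T.onBraid g = ((x23 ^ l : PB 3) : Braid 3) := by
      rw [← cofaceOuter_one_sqSig, ← map_zpow]
      refine Eq.trans (T.onBraid_congr _ _ insObj_std_one_std_one_one.symm
        insObj_std_one_std_one_one.symm ?_)
        (T.onBraid_ins (by norm_num) (show 2 + 2 = 3 + 1 from rfl) 1 hid hl)
      exact congrArg Subtype.val cofaceOuter_one_sqSig.symm
    have ha : T.onBraid PaB.alpha = (f : Braid 3) := by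
      rw [onBraid, hf]
      exact congrArg _ (one_mul (f : Braid 3))
    have e : PaB.mm (n := 2) x23 ≫ PaB.alpha = PaB.alpha ≫ g :=
      PaBHom.ext ((one_mul _).trans (mul_one _).symm)
    have h := congrArg T.onBraid e
    rw [onBraid_comp _ (by norm_num), onBraid_comp _ (by norm_num), ha, hg] at h
    rw [onPB_eq_iff, ← mul_right_inj, h, ← QuotientGroup.mk_mul, ← QuotientGroup.mk_mul]
    congr 1
    simp [mul_assoc]
  -- The two factors of the full twist commute because their product is central, so the `l`-th power
  -- distributes.
  · have hc : Commute x12 ribbonTwist := by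
      have h := (fullTwist_comm x12).eq
      rw [fullTwist, mul_assoc, mul_right_inj] at h
      exact h.symm
    have e : T.onPB 2 fullTwist = T.onPB 2 x12 * T.onPB 2 ribbonTwist :=
      map_mul (T.pbHom 2 (by norm_num)) _ _
    rw [e, h12, hrib, fullTwist, hc.mul_zpow]
    rfl

/-! ### The pentagon relation for a truncated morphism -/

/-- The object `(1(23))4` of `PaB(4)`. -/
def obj1_23_4 : PaB 4 :=
  ⟨.mul (.mul (.of ()) (.mul (.of ()) (.of ()))) (.of ()), rfl, 1⟩

/-- The object `1((23)4)` of `PaB(4)`. -/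
def obj1_of_23_4 : PaB 4 :=
  ⟨.mul (.of ()) (.mul (.mul (.of ()) (.of ())) (.of ())), rfl, 1⟩

/-- The object `1(2(34))` of `PaB(4)`. -/
def obj1_2_34 : PaB 4 :=
  ⟨.mul (.of ()) (.mul (.of ()) (.mul (.of ()) (.of ()))), rfl, 1⟩

/-- The object `(12)(34)` of `PaB(4)`. -/
def obj12_34 : PaB 4 :=
  ⟨.mul (.mul (.of ()) (.of ())) (.mul (.of ()) (.of ())), rfl, 1⟩

/-- The trivial braid, as a morphism between parenthesizations of the word `12…n`. -/
def trivialHom {n : ℕ} (a b : PaB n) (ha : a.perm = 1) (hb : b.perm = 1) : a ⟶ b :=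
  ⟨1, by rw [ha, hb, map_one, inv_one, one_mul]⟩

/-- The pentagon relation. -/
theorem pentagon {f : PB 3} (hf : T.map PaB.alpha = ⟦PaB.mm (n := 2) f ≫ PaB.alpha⟧) :
    ((PaB.cofaceOuter 2 1 f * PaB.cofaceInner 2 1 f * PaB.cofaceOuter 2 0 f : PB 4) :
      PB 4 ⧸ K.sub 4) = (PaB.cofaceInner 2 2 f * PaB.cofaceInner 2 0 f : PB 4) := by
  have hid : T.map (𝟙 (PaB.std 1)) = ⟦𝟙 (PaB.std 1)⟧ := T.map_id (by norm_num) _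
  have hou : (PaB.mm (n := 2) f ≫ PaB.alpha).ou = (f : Braid 3) := one_mul _
  -- Every edge of the pentagon is a trivial braid. It is `α` inserted into an identity (here) or an
  -- identity inserted into `α` (`inner`), so its image is the corresponding coface of `f`.
  have outer : ∀ (q : Fin 2) (a b : PaB 4) (ha : a.perm = 1) (hb : b.perm = 1),
      a = PaB.insObj (show 2 + 3 = 4 + 1 from rfl) q (PaB.std 1) (PaB.std 2) →
      b = PaB.insObj (show 2 + 3 = 4 + 1 from rfl) q (PaB.std 1) PaB.obj1_23 →
      T.onBraid (trivialHom a b ha hb) = ((PaB.cofaceOuter 2 q f : PB 4) : Braid 4) := by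
    intro q a b ha hb h1 h2
    refine (T.onBraid_congr _ _ h1 h2 ?_).trans
      (Eq.trans (T.onBraid_ins (by norm_num) (show 2 + 3 = 4 + 1 from rfl) q hid hf) ?_)
    · exact (Braid.insert_one _ _).symm
    · rw [hou]; rfl
  have inner : ∀ (p : Fin 3) (a b : PaB 4) (ha : a.perm = 1) (hb : b.perm = 1),
      a = PaB.insObj (show 3 + 2 = 4 + 1 from rfl) p (PaB.std 2) (PaB.std 1) →
      b = PaB.insObj (show 3 + 2 = 4 + 1 from rfl) p PaB.obj1_23 (PaB.std 1) →
      T.onBraid (trivialHom a b ha hb) = ((PaB.cofaceInner 2 p f : PB 4) : Braid 4) := by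
    intro p a b ha hb h1 h2
    refine (T.onBraid_congr _ _ h1 h2 ?_).trans
      (Eq.trans (T.onBraid_ins (by norm_num) (show 3 + 2 = 4 + 1 from rfl) p hf hid) ?_)
    · exact (Braid.insert_one _ _).symm
    · rw [hou]; rfl
  have comp : ∀ (a b c : PaB 4) (ha : a.perm = 1) (hb : b.perm = 1) (hc : c.perm = 1),
      T.onBraid (trivialHom a c ha hc) =
        T.onBraid (trivialHom b c hb hc) * T.onBraid (trivialHom a b ha hb) := by
    intro a b c ha hb hc
    rw [← onBraid_comp _ le_rfl]
    exact T.onBraid_congr _ _ rfl rfl (mul_one 1).symm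
  have o0 := outer 0 (PaB.std 3) obj1_23_4 rfl rfl (PaB.ext rfl (insPerm_one _ _).symm)
    (PaB.ext rfl (insPerm_one _ _).symm)
  have o1 := outer 1 obj1_of_23_4 obj1_2_34 rfl rfl (PaB.ext rfl (insPerm_one _ _).symm)
    (PaB.ext rfl (insPerm_one _ _).symm)
  have i0 := inner 0 (PaB.std 3) obj12_34 rfl rfl (PaB.ext rfl (insPerm_one _ _).symm)
    (PaB.ext rfl (insPerm_one _ _).symm)
  have i1 := inner 1 obj1_23_4 obj1_of_23_4 rfl rfl (PaB.ext rfl (insPerm_one _ _).symm)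
    (PaB.ext rfl (insPerm_one _ _).symm)
  have i2 := inner 2 obj12_34 obj1_2_34 rfl rfl (PaB.ext rfl (insPerm_one _ _).symm)
    (PaB.ext rfl (insPerm_one _ _).symm)
  -- The two paths from `((12)3)4` to `1(2(34))` are the same trivial braid: through `(12)(34)`, and
  -- through `(1(23))4` and `1((23)4)`.
  have A := comp (PaB.std 3) obj12_34 obj1_2_34 rfl rfl rfl
  have B := comp (PaB.std 3) obj1_23_4 obj1_2_34 rfl rfl rfl
  rw [comp obj1_23_4 obj1_of_23_4 obj1_2_34 rfl rfl rfl, A, o0, o1, i0, i1, i2] at B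
  exact NFI.mk_coe_eq_iff.mp B.symm

end TruncHom

/-! ### Linking numbers -/

namespace Braid

theorem pair_wreath_left {n : ℕ} {A : Type*} [Group A]
    (x y : (Fin n × Fin n → A) ⋊[mulAutArrow] Equiv.Perm (Fin n)) (q : Fin n × Fin n) :
    (x * y).left q = x.left q * y.left (x.right⁻¹ q.1, x.right⁻¹ q.2) := rfl

/-- The contribution of the crossing `σ_{j+1}` to the ordered pair of positions `(p, q)`. -/
def crossing {A : Type*} [CommGroup A] (a : A) (j p q : ℕ) : A :=
  if p = j ∧ q = j + 1 then a else 1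

/-- For distant `i` and `j`, the transposition at `i` fixes the positions `j` and `j + 1`. -/
theorem crossing_adjSwap {A : Type*} [CommGroup A] (a : A) {n : ℕ} (i j : Fin (n - 1))
    (h : (i : ℕ) + 2 ≤ j ∨ (j : ℕ) + 2 ≤ i) (p q : Fin n) :
    crossing a j (adjSwap i p) (adjSwap i q) = crossing a j p q := by
  have key : ∀ (p : Fin n) (r : ℕ), (r = j ∨ r = j + 1) → ((adjSwap i p : ℕ) = r ↔ (p : ℕ) = r) := by
    intro p r hr
    rw [adjSwap_val]
    split_ifs <;> omega
  simp only [crossing, key _ _ (Or.inl rfl), key _ _ (Or.inr rfl)]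

/-- On both sides of the braid relation each pair of the three strands crosses exactly once. The
proof checks all positions of `p` and `q` relative to `i`, `i + 1`, `i + 2`. -/
theorem crossing_braid {A : Type*} [CommGroup A] (a : A) (i p q : ℕ) (s : ℕ → ℕ → ℕ)
    (hs : ∀ a q, s a q = if q = a then a + 1 else if q = a + 1 then a else q) :
    crossing a i p q * crossing a (i + 1) (s i p) (s i q) *
        crossing a i (s (i + 1) (s i p)) (s (i + 1) (s i q)) =
      crossing a (i + 1) p q * crossing a i (s (i + 1) p) (s (i + 1) q) *
        crossing a (i + 1) (s i (s (i + 1) p)) (s i (s (i + 1) q)) := by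
  have h1 : ∀ x : ℕ, x = i ∨ x = i + 1 ∨ x = i + 2 ∨ (x ≠ i ∧ x ≠ i + 1 ∧ x ≠ i + 2) :=
    fun x => by omega
  have a0 : s i i = i + 1 := by rw [hs]; split_ifs <;> omega
  have a1 : s i (i + 1) = i := by rw [hs]; split_ifs <;> omega
  have a2 : s i (i + 2) = i + 2 := by rw [hs]; split_ifs <;> omega
  have b0 : s (i + 1) i = i := by rw [hs]; split_ifs <;> omega
  have b1 : s (i + 1) (i + 1) = i + 2 := by rw [hs]; split_ifs <;> omega
  have b2 : s (i + 1) (i + 2) = i + 1 := by rw [hs]; split_ifs <;> omega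
  have a3 : ∀ x, (x ≠ i ∧ x ≠ i + 1 ∧ x ≠ i + 2) → s i x = x := by
    intro x hx; rw [hs]; split_ifs <;> omega
  have b3 : ∀ x, (x ≠ i ∧ x ≠ i + 1 ∧ x ≠ i + 2) → s (i + 1) x = x := by
    intro x hx; rw [hs]; split_ifs <;> omega
  rcases h1 p with h | h | h | h <;> rcases h1 q with h' | h' | h' | h' <;>
    simp only [h, h', a0, a1, a2, b0, b1, b2, a3 _, b3 _, crossing, ne_eq, not_false_eq_true, and_self] <;>
    simp [add_assoc]

/-- The crossing homomorphism: the generator `σ_{j+1}` contributes `a` to the ordered pair of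
positions `(j, j + 1)`. On pure braids it gives the powers of `a` by the linking numbers. -/
def linkHom {A : Type*} [CommGroup A] (n : ℕ) (a : A) :
    Braid n →* ((Fin n × Fin n → A) ⋊[mulAutArrow] Equiv.Perm (Fin n)) :=
  lift (fun j => ⟨fun q => crossing a j q.1 q.2, adjSwap j⟩)
    (by
      intro i j h
      ext1
      · funext q
        rw [pair_wreath_left, pair_wreath_left]
        simp only [adjSwap_inv]
        rw [crossing_adjSwap a i j (Or.inl h), crossing_adjSwap a j i (Or.inr h), mul_comm]
      · have := congrArg (rho n) (sig_comm n h)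
        simpa [sig_of] using this)
    (by
      intro i j h
      obtain ⟨j, hj⟩ := j
      obtain rfl : j = i + 1 := h
      ext1
      · funext q
        have := crossing_braid a i q.1 q.2 _ (fun a q => rfl)
        simp only [pair_wreath_left, SemidirectProduct.mul_right, mul_inv_rev,
          Equiv.Perm.mul_apply, adjSwap_inv, adjSwap_val]
        exact this
      · have := congrArg (rho n) (sig_braid n (i := i) hj)
        simpa [sig_of, sig, hj] using this)


theorem linkHom_right {A : Type*} [CommGroup A] {n : ℕ} (a : A) (g : Braid n) :
    (linkHom n a g).right = rho n g := by
  have : SemidirectProduct.rightHom.comp (linkHom n a) = rho n :=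
    PresentedGroup.ext fun i => by simp [linkHom]
  exact DFunLike.congr_fun this g

theorem linkHom_mul {A : Type*} [CommGroup A] {n : ℕ} (a : A) (g h : Braid n) (q : Fin n × Fin n) :
    (linkHom n a (g * h)).left q =
      (linkHom n a g).left q * (linkHom n a h).left ((rho n g)⁻¹ q.1, (rho n g)⁻¹ q.2) := by
  rw [map_mul, pair_wreath_left, linkHom_right]

theorem linkHom_inv {A : Type*} [CommGroup A] {n : ℕ} (a : A) (g : Braid n) (q : Fin n × Fin n) :
    (linkHom n a g⁻¹).left q = ((linkHom n a g).left (rho n g q.1, rho n g q.2))⁻¹ := by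
  have h := linkHom_mul a g g⁻¹ (rho n g q.1, rho n g q.2)
  rw [mul_inv_cancel, map_one] at h
  have e : ∀ x, (rho n g)⁻¹ (rho n g x) = x := (rho n g).symm_apply_apply
  simp only [e] at h
  exact (inv_eq_of_mul_eq_one_right h.symm).symm

/-- Naturality in the coefficient group: values computed over `ℤ` transfer to any element of any
commutative group, in particular to residues modulo `d`. -/
theorem linkHom_map {A B : Type*} [CommGroup A] [CommGroup B] {n : ℕ} (φ : A →* B) (a : A)
    (g : Braid n) (q : Fin n × Fin n) :
    (linkHom n (φ a) g).left q = φ ((linkHom n a g).left q) := by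
  induction g using Braid.induction generalizing q with
  | h1 => simp
  | hg i =>
    simp only [linkHom, lift_of, crossing]
    split_ifs <;> simp
  | hm x y hx hy => rw [linkHom_mul, linkHom_mul, hx, hy, map_mul]
  | hi x hx =>
    rw [linkHom_inv, linkHom_inv, hx, map_inv]

end Braid

/-- The linking number of the strands `p` and `q` of a pure braid, as an exponent of `a`. -/
def linking {A : Type*} [CommGroup A] {n : ℕ} (a : A) (p q : Fin n) : PB n →* A :=
  MonoidHom.mk' (fun h => (Braid.linkHom n a h).left (p, q)) fun g h => by
    -- The crossing count is a cocycle twisted by the permutation; on pure braids the twist is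
    -- trivial and it becomes a homomorphism.
    have hg : Braid.rho n g = 1 := g.2
    rw [Subgroup.coe_mul, Braid.linkHom_mul, hg]
    rfl

theorem linking_map {A B : Type*} [CommGroup A] [CommGroup B] {n : ℕ} (φ : A →* B) (a : A)
    (p q : Fin n) (h : PB n) : linking (φ a) p q h = φ (linking a p q h) :=
  Braid.linkHom_map φ a (h : Braid n) (p, q)

/-- The universal value of the exponent of linking numbers. -/
abbrev intGen : Multiplicative ℤ := Multiplicative.ofAdd 1

theorem linking_eq_zpow {A : Type*} [CommGroup A] {n : ℕ} (a : A) (p q : Fin n) (h : PB n) :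
    linking a p q h = zpowersHom A a (linking intGen p q h) := by
  rw [← linking_map]
  simp

theorem hom_ext_PB_three {G : Type*} [Group G] {φ ψ : PB 3 →* G} (h12 : φ x12 = ψ x12)
    (h23 : φ x23 = ψ x23) (hc : φ fullTwist = ψ fullTwist) : φ = ψ := by
  refine MonoidHom.eq_of_eqOn_dense closure_PB_three ?_
  rintro _ (rfl | rfl | rfl)
  · exact h12
  · exact h23
  · exact hc

/-- Both sides are homomorphisms on `PB₃`, so three generators suffice; the integral hypotheses on
them are concrete computations that `decide` can settle. -/
theorem linking_comp {A : Type*} [CommGroup A] (a : A) (φ : PB 3 →* PB 4) (p q : Fin 4)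
    (p' q' : Fin 3) (h12 : linking intGen p q (φ x12) = linking intGen p' q' x12)
    (h23 : linking intGen p q (φ x23) = linking intGen p' q' x23)
    (hc : linking intGen p q (φ fullTwist) = linking intGen p' q' fullTwist) (h : PB 3) :
    linking a p q (φ h) = linking a p' q' h := by
  have : (linking intGen p q).comp φ = linking intGen p' q' := hom_ext_PB_three h12 h23 hc
  rw [linking_eq_zpow, linking_eq_zpow a p' q', ← this]
  rfl

theorem linking_comp_eq_one {A : Type*} [CommGroup A] (a : A) (φ : PB 3 →* PB 4) (p q : Fin 4)
    (h12 : linking intGen p q (φ x12) = 1) (h23 : linking intGen p q (φ x23) = 1)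
    (hc : linking intGen p q (φ fullTwist) = 1) (h : PB 3) :
    linking a p q (φ h) = 1 := by
  have : (linking intGen p q).comp φ = 1 := hom_ext_PB_three h12 h23 hc
  have h' := DFunLike.congr_fun this h
  rw [MonoidHom.comp_apply, MonoidHom.one_apply] at h'
  rw [linking_eq_zpow, h', map_one]

/-! ### Consequences of the pentagon for linking numbers -/

set_option maxRecDepth 10000 in
/-- The pentagon relation determines all linking numbers. -/
theorem linking_eq_one_of_pentagon {A : Type*} [CommGroup A] (a : A) (f : PB 3)
    (h : ∀ p q : Fin 4, linking a p q
        (PaB.cofaceOuter 2 1 f * PaB.cofaceInner 2 1 f * PaB.cofaceOuter 2 0 f) =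
      linking a p q (PaB.cofaceInner 2 2 f * PaB.cofaceInner 2 0 f)) :
    linking a 0 1 f = 1 ∧ linking a 1 2 f = 1 ∧ linking a 0 2 f = 1 := by
  -- For each of these pairs two terms on one side and one on the other reproduce the same linking
  -- number `ℓ` of `f`. The other two terms vanish, the pair being parallel strands of a cable or
  -- containing an added vertical strand; hence `2ℓ = ℓ`.
  have h01 := h 0 1
  have h23 := h 2 3
  have h03 := h 0 3
  simp only [map_mul] at h01 h23 h03
  rw [linking_comp_eq_one a (PaB.cofaceOuter 2 1) 0 1 (by decide) (by decide) (by decide),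
    linking_comp a (PaB.cofaceInner 2 1) 0 1 0 1 (by decide) (by decide) (by decide),
    linking_comp a (PaB.cofaceOuter 2 0) 0 1 0 1 (by decide) (by decide) (by decide),
    linking_comp a (PaB.cofaceInner 2 2) 0 1 0 1 (by decide) (by decide) (by decide),
    linking_comp_eq_one a (PaB.cofaceInner 2 0) 0 1 (by decide) (by decide) (by decide)] at h01
  rw [linking_comp a (PaB.cofaceOuter 2 1) 2 3 1 2 (by decide) (by decide) (by decide),
    linking_comp a (PaB.cofaceInner 2 1) 2 3 1 2 (by decide) (by decide) (by decide),
    linking_comp_eq_one a (PaB.cofaceOuter 2 0) 2 3 (by decide) (by decide) (by decide),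
    linking_comp_eq_one a (PaB.cofaceInner 2 2) 2 3 (by decide) (by decide) (by decide),
    linking_comp a (PaB.cofaceInner 2 0) 2 3 1 2 (by decide) (by decide) (by decide)] at h23
  rw [linking_comp_eq_one a (PaB.cofaceOuter 2 1) 0 3 (by decide) (by decide) (by decide),
    linking_comp a (PaB.cofaceInner 2 1) 0 3 0 2 (by decide) (by decide) (by decide),
    linking_comp_eq_one a (PaB.cofaceOuter 2 0) 0 3 (by decide) (by decide) (by decide),
    linking_comp a (PaB.cofaceInner 2 2) 0 3 0 2 (by decide) (by decide) (by decide),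
    linking_comp a (PaB.cofaceInner 2 0) 0 3 0 2 (by decide) (by decide) (by decide)] at h03
  exact ⟨by simpa using h01, by simpa using h23, by simpa using h03⟩

theorem linking_outer_zero {A : Type*} [CommGroup A] (a : A) (h : PB 3) :
    linking a 0 2 (PaB.cofaceOuter 2 0 h) = linking a 0 2 h :=
  linking_comp a _ 0 2 0 2 (by decide) (by decide) (by decide) h

/-- The table of exponents is invertible over `ℤ`, and its last row isolates the full twist: strands
1 and 3 are linked by it alone. -/
theorem linking_generators {A : Type*} [CommGroup A] (a : A) :
    (linking a 0 1 x12 = a ∧ linking a 0 1 x23 = 1 ∧ linking a 0 1 fullTwist = a) ∧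
    (linking a 1 2 x12 = 1 ∧ linking a 1 2 x23 = a ∧ linking a 1 2 fullTwist = a) ∧
    (linking a 0 2 x12 = 1 ∧ linking a 0 2 x23 = 1 ∧ linking a 0 2 fullTwist = a) := by
  have key : ∀ (p q : Fin 3) (h : PB 3) (k : ℤ), linking intGen p q h = Multiplicative.ofAdd k →
      linking a p q h = a ^ k := by
    intro p q h k hk
    rw [linking_eq_zpow, hk]
    rfl
  refine ⟨⟨?_, ?_, ?_⟩, ⟨?_, ?_, ?_⟩, ⟨?_, ?_, ?_⟩⟩
  · simpa using key 0 1 x12 1 (by decide)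
  · simpa using key 0 1 x23 0 (by decide)
  · simpa using key 0 1 fullTwist 1 (by decide)
  · simpa using key 1 2 x12 0 (by decide)
  · simpa using key 1 2 x23 1 (by decide)
  · simpa using key 1 2 fullTwist 1 (by decide)
  · simpa using key 0 2 x12 0 (by decide)
  · simpa using key 0 2 x23 0 (by decide)
  · simpa using key 0 2 fullTwist 1 (by decide)

theorem linking_eq_one_of_mem_F2 {A : Type*} [CommGroup A] (a : A) {u : PB 3} (hu : u ∈ F2) :
    linking a 0 2 u = 1 := by
  have : F2 ≤ (linking a 0 2).ker := by
    rw [F2, Subgroup.closure_le]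
    rintro _ (rfl | rfl)
    · exact (linking_generators a).2.2.1
    · exact (linking_generators a).2.2.2.1
  exact this hu

theorem map_eq_one_of_mem_commutator {G A : Type*} [Group G] [CommGroup A] (φ : G →* A)
    {H : Subgroup G} {z : G} (hz : z ∈ ⁅H, H⁆) : φ z = 1 := by
  have : ⁅H, H⁆ ≤ φ.ker := by
    rw [Subgroup.commutator_le]
    intro x _ y _
    rw [MonoidHom.mem_ker, map_commutatorElement, commutatorElement_eq_one_iff_mul_comm, mul_comm]
  exact this hz

/-- A pure braid whose linking numbers vanish modulo the order of `a` is the product of an element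
of `[F₂, F₂]` and of an element of any normal subgroup that contains the powers with this order. -/
theorem exists_commutator_of_linking {A : Type*} [CommGroup A] (a : A) (M : Subgroup (PB 3))
    [M.Normal] (hM : ∀ h : PB 3, h ^ orderOf a ∈ M) {f : PB 3} (h01 : linking a 0 1 f = 1)
    (h12 : linking a 1 2 f = 1) (h02 : linking a 0 2 f = 1) :
    ∃ z ∈ ⁅F2, F2⁆, (z : PB 3 ⧸ M) = f := by
  obtain ⟨u, hu, k, rfl⟩ := exists_F2_mul_fullTwist f
  obtain ⟨b, c, z, hz, rfl⟩ := exists_commutator_of_mem_F2 hu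
  obtain ⟨⟨g1, g2, g3⟩, ⟨g4, g5, g6⟩, ⟨g7, g8, g9⟩⟩ := linking_generators a
  simp only [map_mul, map_zpow, map_eq_one_of_mem_commutator _ hz, g1, g2, g3, g4, g5, g6, g7, g8,
    g9, one_zpow, mul_one, one_mul] at h01 h12 h02
  -- The pair `(0, 2)` kills the full twist exponent first; the other two pairs then isolate the
  -- exponents of `x₁₂` and `x₂₃`.
  rw [h02, mul_one] at h01 h12
  have key : ∀ (h : PB 3) {e : ℤ}, a ^ e = 1 → ((h ^ e : PB 3) : PB 3 ⧸ M) = 1 := by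
    intro h e he
    obtain ⟨e, rfl⟩ := orderOf_dvd_iff_zpow_eq_one.mpr he
    rw [QuotientGroup.eq_one_iff, zpow_mul, zpow_natCast]
    exact zpow_mem (hM h) e
  refine ⟨z, hz, ?_⟩
  simp only [QuotientGroup.mk_mul, key _ h01, key _ h12, key _ h02, one_mul, mul_one]

/-! ### Refining N by linking numbers modulo d -/

namespace NFI

/-- The intersection of `N` with the group of the pure braids all of whose linking numbers are
divisible by `d`. -/
def refine (K : NFI) (d : ℕ) [NeZero d] : NFI where
  N := K.N ⊓ (Braid.linkHom 4 (Multiplicative.ofAdd (1 : ZMod d))).ker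
  normal := by
    have := K.normal
    infer_instance
  finiteIndex := by
    have := K.finiteIndex
    have : Finite ((Fin 4 × Fin 4 → Multiplicative (ZMod d)) ⋊[mulAutArrow] Equiv.Perm (Fin 4)) :=
      Finite.of_equiv _ SemidirectProduct.equivProd.symm
    have := Subgroup.finiteIndex_ker (Braid.linkHom 4 (Multiplicative.ofAdd (1 : ZMod d)))
    infer_instance
  le_PB := inf_le_left.trans K.le_PB

theorem cofacePreimage_mono {n : ℕ} {M M' : Subgroup (PB (n + 2))} (h : M ≤ M') :
    cofacePreimage M ≤ cofacePreimage M' := by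
  intro x hx
  rw [mem_cofacePreimage] at *
  exact ⟨fun q => h (hx.1 q), fun p => h (hx.2 p)⟩

theorem sub_mono {K K' : NFI} (h : K'.N ≤ K.N) (n : ℕ) : K'.sub n ≤ K.sub n := by
  have h4 : K'.N.subgroupOf (PB 4) ≤ K.N.subgroupOf (PB 4) := fun x hx => h hx
  match n with
  | 2 => exact cofacePreimage_mono (cofacePreimage_mono h4)
  | 3 => exact cofacePreimage_mono h4
  | 4 => exact h4
  | 0 => exact le_top
  | 1 => exact le_top
  | _ + 5 => exact le_top

theorem sim_finer {K K' : NFI} (h : K'.N ≤ K.N) (n : ℕ) : (K'.sim n).Finer (K.sim n) :=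
  fun _ _ _ _ hf => sub_mono h n hf

theorem refine_le (K : NFI) (d : ℕ) [NeZero d] : (K.refine d).N ≤ K.N := inf_le_left

theorem linking_refine_four (K : NFI) (d : ℕ) [NeZero d] {h : PB 4} (hh : h ∈ (K.refine d).sub 4)
    (p q : Fin 4) : linking (Multiplicative.ofAdd (1 : ZMod d)) p q h = 1 := by
  have h1 : Braid.linkHom 4 (Multiplicative.ofAdd (1 : ZMod d)) h = 1 :=
    (Subgroup.mem_inf.mp (Subgroup.mem_subgroupOf.mp hh)).2
  change (Braid.linkHom 4 _ (h : Braid 4)).left (p, q) = 1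
  rw [h1]
  rfl

/-- Adding a vertical fourth strand is one of the cofaces defining `N_{PB₃}`, and it preserves the
linking number of strands 1 and 3. That number modulo `d` therefore descends to the quotient of
`PB₃`. -/
theorem linking_refine_three (K : NFI) (d : ℕ) [NeZero d] {h : PB 3}
    (hh : h ∈ (K.refine d).sub 3) : linking (Multiplicative.ofAdd (1 : ZMod d)) 0 2 h = 1 := by
  rw [← linking_outer_zero]
  exact K.linking_refine_four d ((mem_cofacePreimage.mp hh).1 0) 0 2

end NFI

/-! ### Density of a groupoid in its profinite completion -/

namespace FinCong

variable {C : Type*} [Category C]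

/-- The intersection of two compatible equivalence relations. -/
def inf (R S : FinCong C) : FinCong C where
  rel a b := R.rel a b ⊓ S.rel a b
  comp h h' := ⟨R.comp h.1 h'.1, S.comp h.2 h'.2⟩
  finite a b := by
    have := R.finite a b
    have := S.finite a b
    refine Finite.of_injective (β := R.QuotHom a b × S.QuotHom a b)
      (Quotient.lift (s := R.rel a b ⊓ S.rel a b) (fun f => (⟦f⟧, ⟦f⟧))
        fun f g h => Prod.ext (Quotient.sound h.1) (Quotient.sound h.2)) ?_
    rintro ⟨f⟩ ⟨g⟩ h
    exact Quotient.sound (s := R.rel a b ⊓ S.rel a b)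
      ⟨Quotient.exact (congrArg Prod.fst h), Quotient.exact (congrArg Prod.snd h)⟩

/-- The compatible equivalence relation with at most one class of morphisms between any
two objects. -/
def top : FinCong C where
  rel _ _ := ⊤
  comp _ _ := trivial
  finite a b := by
    have : Subsingleton (Quotient (⊤ : Setoid (a ⟶ b))) := Quotient.subsingleton_iff.mpr rfl
    infer_instance

/-- Directedness of the limit defining the completion: finitely many finite quotients are dominated
by a single one. -/
theorem exists_finer (s : Finset (FinCong C)) : ∃ S : FinCong C, ∀ R ∈ s, S.Finer R := by
  classical
  induction s using Finset.induction_on with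
  | empty => exact ⟨top, by simp⟩
  | insert R s _ ih =>
    obtain ⟨S, hS⟩ := ih
    refine ⟨R.inf S, fun R' hR' => ?_⟩
    rcases Finset.mem_insert.mp hR' with rfl | h
    · exact fun _ _ _ _ h => h.1
    · exact fun a b f f' h' => hS R' h a b f f' h'.2

end FinCong

namespace HatHom

theorem continuous_val {C : Type*} [Category C] {a b : C} (R : FinCong C) :
    @Continuous _ _ _ ⊥ fun x : HatHom a b => x.val R := by
  let _ : ∀ R : FinCong C, TopologicalSpace (R.QuotHom a b) := fun _ => ⊥
  exact (continuous_apply R).comp continuous_induced_dom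

/-- The morphisms of a groupoid are dense in its profinite completion. -/
theorem exists_incl_mem {C : Type*} [Category C] {a b : C} {U : Set (HatHom a b)} (hU : IsOpen U)
    {x : HatHom a b} (hx : x ∈ U) : ∃ f : a ⟶ b, incl f ∈ U := by
  let _ : ∀ R : FinCong C, TopologicalSpace (R.QuotHom a b) := fun _ => ⊥
  obtain ⟨V, hV, rfl⟩ := isOpen_induced_iff.mp hU
  -- A basic neighbourhood constrains only finitely many coordinates, and one representative at a
  -- common refinement matches `x` in all of them.
  obtain ⟨s, u, hu, hsub⟩ := isOpen_pi_iff.mp hV x.val hx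
  obtain ⟨S, hS⟩ := FinCong.exists_finer s
  obtain ⟨f, hf⟩ := Quotient.exists_rep (x.val S)
  refine ⟨f, hsub fun R hR => ?_⟩
  have h := x.compat S R (hS R hR) f hf.symm
  have h' := (hu R hR).2
  rw [h] at h'
  exact h'

end HatHom

/-! ### The quotient maps induced by an automorphism -/

namespace PaBHatAut

variable (T : PaBHatAut)

/-- The preimage of `w` under the automorphism exists only in the completion. By continuity, having
image congruent to `w` modulo `∼_N` is an open condition, so density supplies an honest pure braid
satisfying it. -/
theorem onPB_surjective (K : NFI) (n : ℕ) : Function.Surjective ((T.toTruncHom K).onPB n) := by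
  intro y
  obtain ⟨w, rfl⟩ := QuotientGroup.mk_surjective y
  let x := T.map.symm (HatHom.incl (PaB.mm w))
  have hU : IsOpen {z : HatHom (PaB.std n) (PaB.std n) |
      K.proj (T.map z) = ⟦PaB.mm w⟧} := by
    let _ : TopologicalSpace ((K.sim (n + 1)).QuotHom (PaB.std n) (PaB.std n)) := ⊥
    have : DiscreteTopology ((K.sim (n + 1)).QuotHom (PaB.std n) (PaB.std n)) := ⟨rfl⟩
    exact (isOpen_discrete {(⟦PaB.mm w⟧ : (K.sim (n + 1)).QuotHom (PaB.std n) (PaB.std n))}).preimage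
      ((HatHom.continuous_val (K.sim (n + 1))).comp T.map.continuous)
  have hx : K.proj (T.map x) = ⟦PaB.mm w⟧ := by
    rw [T.map.apply_symm_apply]
    rfl
  obtain ⟨f, hf⟩ := HatHom.exists_incl_mem hU hx
  refine ⟨PaB.ouPure f, ?_⟩
  change K.quotOu (K.proj (T.map (HatHom.incl f))) = _
  rw [show K.proj (T.map (HatHom.incl f)) = ⟦PaB.mm w⟧ from hf]
  rfl

/-- The components of a point of the limit are compatible, so a representative of the image for the
smaller subgroup also represents it for the larger one. -/
theorem map_of_finer {K K' : NFI} (h : K'.N ≤ K.N) {n : ℕ} {a b : PaB n} {f g : a ⟶ b}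
    (hf : (T.toTruncHom K').map f = ⟦g⟧) : (T.toTruncHom K).map f = ⟦g⟧ :=
  (T.map (HatHom.incl f)).compat _ _ (NFI.sim_finer h n) g hf

theorem onPB_of_finer {K K' : NFI} (h : K'.N ≤ K.N) {n : ℕ} {u v : PB (n + 1)}
    (hu : (T.toTruncHom K').onPB n u = v) : (T.toTruncHom K).onPB n u = v := by
  obtain ⟨g, hg⟩ := Quotient.exists_rep ((T.toTruncHom K').map (PaB.mm u))
  have hv : (PaB.ouPure g : PB (n + 1) ⧸ K'.sub (n + 1)) = v := by
    rw [← hu, TruncHom.onPB, ← hg]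
    rfl
  rw [TruncHom.onPB, T.map_of_finer h hg.symm]
  exact QuotientGroup.eq.mpr (NFI.sub_mono h _ (QuotientGroup.eq.mp hv))

end PaBHatAut

namespace TruncHom

theorem exists_map_alpha {K : NFI} (T : TruncHom K) :
    ∃ f : PB 3, T.map PaB.alpha = ⟦PaB.mm (n := 2) f ≫ PaB.alpha⟧ := by
  obtain ⟨g, hg⟩ := Quotient.exists_rep (T.map PaB.alpha)
  refine ⟨⟨g.ou, ?_⟩, hg.symm.trans (congrArg _ (PaBHom.ext (one_mul _).symm))⟩
  rw [MonoidHom.mem_ker, g.rho_ou]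
  exact inv_mul_cancel 1

/-- The image of `α` determines the coset of `f`; this identifies the lifted `f'` with `f` modulo
`N_{PB₃}`. -/
theorem eq_of_map_alpha {K : NFI} {T : TruncHom K} {f f' : PB 3}
    (h : T.map PaB.alpha = ⟦PaB.mm (n := 2) f ≫ PaB.alpha⟧)
    (h' : T.map PaB.alpha = ⟦PaB.mm (n := 2) f' ≫ PaB.alpha⟧) : (f : PB 3 ⧸ K.sub 3) = f' := by
  have e := congrArg K.quotBraid (h.symm.trans h')
  have hou : ∀ f : PB 3, (PaB.mm (n := 2) f ≫ PaB.alpha).ou = (f : Braid 3) := fun f => one_mul _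
  rw [NFI.quotBraid_mk, NFI.quotBraid_mk, hou, hou] at e
  exact NFI.mk_coe_eq_iff.mp e

end TruncHom

namespace NFI

variable {K : NFI}

theorem quotF2_injective (K : NFI) : Function.Injective K.quotF2 := by
  rw [injective_iff_map_eq_one]
  intro x hx
  obtain ⟨u, rfl⟩ := QuotientGroup.mk_surjective x
  exact (QuotientGroup.eq_one_iff u).mpr ((QuotientGroup.eq_one_iff (u : PB 3)).mp hx)

theorem mem_range_quotF2 {u : PB 3} (hu : u ∈ F2) : (u : PB 3 ⧸ K.sub 3) ∈ K.quotF2.range :=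
  ⟨((⟨u, hu⟩ : F2) : F2 ⧸ K.subF2), rfl⟩

theorem exists_pow_mem_sub_three (K : NFI) :
    ∃ d : ℕ, d ≠ 0 ∧ ∀ h : PB 3, h ^ d ∈ K.sub 3 := by
  have := K.sub_finiteIndex 3
  refine ⟨(K.sub 3).index, this.index_ne_zero, fun h => ?_⟩
  exact Subgroup.pow_index_mem _ h

theorem orderOf_ofAdd_one (d : ℕ) : orderOf (Multiplicative.ofAdd (1 : ZMod d)) = d := by
  rw [orderOf_ofAdd_eq_addOrderOf, ZMod.addOrderOf_one]

end NFI

/-! ### Genuine shadows are charming -/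

theorem proposition2p16 (K : NFI) (m : ℤ) (f : PB 3) (h : K.IsGenuine m f) :
    K.IsCharming m f := by
  obtain ⟨hsh, S, hS⟩ := h
  obtain ⟨d, hd, hpow⟩ := K.exists_pow_mem_sub_three
  have : NeZero d := ⟨hd⟩
  -- Exponents of `a` are integers modulo `d`, and `d`-th powers in `PB₃` lie in `N_{PB₃}`.
  let a := Multiplicative.ofAdd (1 : ZMod d)
  have ha : orderOf a = d := NFI.orderOf_ofAdd_one d
  have hle : (K.refine d).N ≤ K.N := K.refine_le d
  set T := S.toTruncHom K with hT
  set T' := S.toTruncHom (K.refine d) with hT'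
  obtain ⟨f', hf'⟩ := T'.exists_map_alpha
  have hff' : (f' : PB 3 ⧸ K.sub 3) = f := TruncHom.eq_of_map_alpha (S.map_of_finer hle hf') hS.1
  have hcomm : ∃ f₁ ∈ ⁅F2, F2⁆, (f₁ : PB 3 ⧸ K.sub 3) = f := by
    -- The pentagon is used modulo the refined subgroup, where it yields an equality of linking
    -- numbers modulo `d`.
    have hp := T'.pentagon hf'
    obtain ⟨h01, h12, h02⟩ := linking_eq_one_of_pentagon a f' fun p q => by
      have := K.linking_refine_four d (QuotientGroup.eq.mp hp) p q
      rwa [map_mul, map_inv, inv_mul_eq_one] at this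
    rw [← hff']
    exact exists_commutator_of_linking a (K.sub 3) (by rwa [ha]) h01 h12 h02
  obtain ⟨f₁, hf₁, hff₁⟩ := hcomm
  have hf₁F : f₁ ∈ F2 := Subgroup.commutator_le_self F2 hf₁
  obtain ⟨l, hl12, hl23, -⟩ := T.exists_onPB_generators hS.1
  have h12F : x12 ∈ F2 := Subgroup.subset_closure (Or.inl rfl)
  have h23F : x23 ∈ F2 := Subgroup.subset_closure (Or.inr rfl)
  let τ := T.pbHom 2 (by norm_num)
  -- Since `f` and `f₁` have the same coset, the conjugating element in the image of `x₂₃` can be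
  -- taken in `F₂`.
  have hτ : ∀ u ∈ F2, τ u ∈ K.quotF2.range := by
    have : F2 ≤ K.quotF2.range.comap τ := by
      refine (Subgroup.closure_le _).mpr ?_
      rintro _ (rfl | rfl)
      · change T.onPB 2 x12 ∈ K.quotF2.range
        rw [hl12]
        exact NFI.mem_range_quotF2 (zpow_mem h12F l)
      · change T.onPB 2 x23 ∈ K.quotF2.range
        have e : ((f⁻¹ * x23 ^ l * f : PB 3) : PB 3 ⧸ K.sub 3) = (f₁⁻¹ * x23 ^ l * f₁ : PB 3) := by
          simp only [QuotientGroup.mk_mul, QuotientGroup.mk_inv, hff₁]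
        rw [hl23, e]
        exact NFI.mem_range_quotF2 (mul_mem (mul_mem (inv_mem hf₁F) (zpow_mem h23F l)) hf₁F)
    exact this
  let t : F2 →* F2 ⧸ K.subF2 := (MonoidHom.ofInjective K.quotF2_injective).symm.toMonoidHom.comp
    ((τ.comp F2.subtype).codRestrict K.quotF2.range fun w => hτ w w.2)
  have ht : ∀ w : F2, K.quotF2 (t w) = T.onPB 2 (w : PB 3) := fun w =>
    MonoidHom.apply_ofInjective_symm K.quotF2_injective ⟨τ w, hτ w w.2⟩
  refine ⟨hsh, ⟨f₁, hf₁, hff₁⟩, T, hS, t, ht, fun y => ?_⟩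
  obtain ⟨w, rfl⟩ := QuotientGroup.mk_surjective y
  obtain ⟨l', hl12', hl23', hlc'⟩ := T'.exists_onPB_generators hf'
  -- The preimage of `w` is taken for `T'`, not for `T`, so that the linking numbers of both sides
  -- can be compared modulo `d`.
  obtain ⟨v, hv⟩ := S.onPB_surjective (K.refine d) 2 (w : PB 3)
  obtain ⟨u, hu, k, rfl⟩ := exists_F2_mul_fullTwist v
  let τ' := T'.pbHom 2 (by norm_num)
  let lk : PB 3 ⧸ (K.refine d).sub 3 →* Multiplicative (ZMod d) :=
    QuotientGroup.lift _ (linking a 0 2) fun h hh => K.linking_refine_three d hh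
  -- The image of `x₁₂` is a power of `x₁₂` and that of `x₂₃` is conjugate to a power of `x₂₃`;
  -- neither links strands 1 and 3.
  have hlk : ∀ u ∈ F2, lk (τ' u) = 1 := by
    have : F2 ≤ (lk.comp τ').ker := by
      rw [F2, Subgroup.closure_le]
      rintro _ (rfl | rfl)
      · change lk (T'.onPB 2 x12) = 1
        rw [hl12']
        change linking a 0 2 _ = 1
        rw [map_zpow, (linking_generators a).2.2.1, one_zpow]
      · change lk (T'.onPB 2 x23) = 1
        rw [hl23']
        change linking a 0 2 _ = 1
        rw [map_mul, map_mul, map_zpow, map_inv, (linking_generators a).2.2.2.1, one_zpow, mul_one,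
          inv_mul_cancel]
    exact this
  have hc : τ' (fullTwist ^ k) = ((fullTwist ^ (l' * k) : PB 3) : PB 3 ⧸ (K.refine d).sub 3) := by
    rw [map_zpow, zpow_mul]
    exact congrArg (· ^ k) hlc'
  have hw : τ' u * ((fullTwist ^ (l' * k) : PB 3) : PB 3 ⧸ (K.refine d).sub 3) = (w : PB 3) := by
    rw [← hc, ← map_mul]
    exact hv
  -- Linking strands 1 and 3 in `hw`, the contributions of `τ' u` and of `w` vanish and only the
  -- power of the full twist remains.
  have hexp : a ^ (l' * k) = 1 := by
    have e := congrArg lk hw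
    rw [map_mul, hlk u hu, one_mul] at e
    change linking a 0 2 _ = linking a 0 2 _ at e
    rwa [linking_eq_one_of_mem_F2 a w.2, map_zpow, (linking_generators a).2.2.2.2] at e
  have hmem : (fullTwist ^ (l' * k) : PB 3) ∈ K.sub 3 := by
    obtain ⟨e, he⟩ := orderOf_dvd_iff_zpow_eq_one.mpr hexp
    rw [he, ha, zpow_mul, zpow_natCast]
    exact zpow_mem (hpow _) e
  -- The equality for `T'` descends to `T`, and there the full twist factor is trivial by `hmem`.
  have hu' : T.onPB 2 u = ((w * (fullTwist ^ (l' * k))⁻¹ : PB 3) : PB 3 ⧸ K.sub 3) := by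
    apply S.onPB_of_finer hle
    change τ' u = _
    rw [QuotientGroup.mk_mul, QuotientGroup.mk_inv, eq_mul_inv_iff_mul_eq]
    exact hw
  refine ⟨⟨u, hu⟩, K.quotF2_injective ?_⟩
  rw [ht, hu', QuotientGroup.mk_mul, QuotientGroup.mk_inv, (QuotientGroup.eq_one_iff _).mpr hmem,
    inv_one, mul_one]
  rfl
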